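/- Let $r\in\mathbb N$. \emph{Definitions.} A \emph{Turing ideal} is a nonempty class $\mathcal M\subseteq\mathfrak P(\mathbb N)$ that is closed under $\oplus$ and downward closed under Turing reducibility. Finite objects are coded by integers in a standard way; strings, colorings and sequences of sets "belong to $\mathcal M$" through their codes. Call a pair $(\rho,\sigma)\in 3^{<\mathbb N}\times(2^{<\mathbb N})^r$ \emph{admissible} if $\sigma_0,\dots,\sigma_{r-1}$ all have the same length and this length is at most $|\rho|$. A \emph{cross-tree} is a set $T$ of admissible pairs such that every admissible pair that is a componentwise prefix of an element of $T$ is in $T$. A \emph{path} through $T$ is a pair $(X,Y)\in 3^{\mathbb N}\times(2^{\mathbb N})^r$ such that $(X{\upharpoonright}_n,(Y_s{\upharpoonright}_n)_{s<r})\in T$ for all $n$; $T$ is \emph{left-full} if for every $X\in 3^{\mathbb N}$ there is $Y\in(2^{\mathbb N})^r$ such that $(X,Y)$ is a path through $T$. Two colorings $a,b:\mathbb N\to k$ are \emph{finitely compatible} if $a^{-1}(i)\cap b^{-1}(i)$ is finite for every $i<k$, and \emph{infinitely compatible} otherwise. A \emph{cross-constraint ideal} (for $r$) is a Turing ideal $\mathcal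 M$ such that every left-full cross-tree $T\in\mathcal M$ has two paths $(X^0,Y^0)$, $(X^1,Y^1)$ such that $(X^0,X^1)$ is finitely compatible, $(Y^0_s,Y^1_s)$ is infinitely compatible for every $s<r$, and $(X^0,Y^0)\oplus(X^1,Y^1)\in\mathcal M$. $\mathcal M\models\mathsf{COH}$ means that for every sequence of sets $(R_n)_{n\in\mathbb N}$ in $\mathcal M$ there is an infinite $C\in\mathcal M$ such that for every $n$, $C\setminus R_n$ or $C\cap R_n$ is finite. A coloring $f:\mathbb N\to 3$ is \emph{hyperimmune relative to} $D\subseteq\mathbb N$ if for every $D$-computable sequence $(F_{n,0},F_{n,1},F_{n,2})_{n\in\mathbb N}$ of triples of mutually disjoint (explicitly given) finite sets, all of whose elements are greater than $n$, there is $N$ such that $F_{N,j}\subseteq f^{-1}(j)$ for every $j<3$. A set $H$ is \emph{homogeneous} for a coloring of $[\mathbb N]^n$ if the coloring is constant on $[H]^n$. \textbf{Theorem.} Let $\mathcal M$ be a countable cross-constraint ideal (for $r$) such that $\mathcal M\models\mathsf{COH}$, and let $f:\mathbb N\to 3$ be hyperimmune relative to every element of $\mathcal M$. Then for all colorings $g_0,\dots,g_{r-1}:[\mathbb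 N]^2\to 2$ in $\mathcal M$ there are infinite sets $G_0,\dots,G_{r-1}$, with $G_i$ homogeneous for $g_i$ for every $i<r$, such that $\bigoplus_{i<r}G_i$ does not compute any infinite $f$-homogeneous set. -/

import Mathlib

namespace CrossConstraint

/-! ### Sets of natural numbers, Turing reducibility, coding -/

open Classical in
/-- The characteristic function of a set of natural numbers. -/
noncomputable def charFun (A : Set ℕ) : ℕ →. ℕ :=
  fun n => Part.some (if n ∈ A then 1 else 0)

/-- `B` computes `A`, i.e. `A ≤_T B`. -/
def Computes (B A : Set ℕ) : Prop := TuringReducible (charFun A) (charFun B)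

/-- The function `h` is computable from the set `D`. -/
def ComputableFrom {α β : Type} [Primcodable α] [Primcodable β] (D : Set ℕ) (h : α → β) : Prop :=
  ComputableIn {charFun D} h

/-- A set of finite objects, seen as a set of natural numbers through the standard coding. -/
def codeSet {α : Type} [Primcodable α] (S : Set α) : Set ℕ := Encodable.encode '' S

/-- The join `A ⊕ B` of two sets. -/
def join (A B : Set ℕ) : Set ℕ := (fun n => 2 * n) '' A ∪ (fun n => 2 * n + 1) '' B

/-- The join `⨁_{i<r} G_i` of a finite sequence of sets. -/
def finJoin {r : ℕ} (G : Fin r → Set ℕ) : Set ℕ := codeSet {p : Fin r × ℕ | p.2 ∈ G p.1}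

/-- A Turing ideal: a nonempty class of sets closed under join and downward closed under
Turing reducibility. -/
structure IsTuringIdeal (M : Set (Set ℕ)) : Prop where
  nonempty : M.Nonempty
  join_mem : ∀ A ∈ M, ∀ B ∈ M, join A B ∈ M
  downward : ∀ B ∈ M, ∀ A : Set ℕ, Computes B A → A ∈ M

/-! ### Cross-trees and the cross-constraint problem -/

/-- Pairs `(ρ, σ)` of a ternary string and an `r`-tuple of binary strings. -/
abbrev Node (r : ℕ) : Type := List (Fin 3) × (Fin r → List (Fin 2))

/-- The components of `σ` have the same length, which is at most the length of `ρ`. -/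
def Node.Admissible {r : ℕ} (χ : Node r) : Prop :=
  (∀ i j, (χ.2 i).length = (χ.2 j).length) ∧ ∀ i, (χ.2 i).length ≤ χ.1.length

/-- The componentwise prefix relation. -/
def Node.Prefix {r : ℕ} (χ ψ : Node r) : Prop :=
  χ.1 <+: ψ.1 ∧ ∀ i, χ.2 i <+: ψ.2 i

/-- A cross-tree: a set of admissible pairs, closed under admissible prefixes. -/
structure IsCrossTree {r : ℕ} (T : Set (Node r)) : Prop where
  admissible : ∀ χ ∈ T, χ.Admissible
  downward : ∀ ψ ∈ T, ∀ χ : Node r, χ.Admissible → χ.Prefix ψ → χ ∈ T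

/-- The initial segment of length `n` of an infinite sequence. -/
def restrict {k : ℕ} (X : ℕ → Fin k) (n : ℕ) : List (Fin k) := (List.range n).map X

/-- `(X, Y)` is an infinite path through `T`. -/
def IsPath {r : ℕ} (T : Set (Node r)) (X : ℕ → Fin 3) (Y : Fin r → ℕ → Fin 2) : Prop :=
  ∀ n, ((restrict X n, fun s => restrict (Y s) n) : Node r) ∈ T

/-- `T` is left-full (below the empty pair). -/
def LeftFull {r : ℕ} (T : Set (Node r)) : Prop :=
  ∀ X : ℕ → Fin 3, ∃ Y : Fin r → ℕ → Fin 2, IsPath T X Y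

/-- Two `k`-colorings of `ℕ` are finitely compatible if no color is taken by both of them at
infinitely many common points. They are infinitely compatible if they are not finitely
compatible. -/
def FinitelyCompatible {k : ℕ} (f g : ℕ → Fin k) : Prop :=
  ∀ c, {n | f n = c ∧ g n = c}.Finite

/-- The pair `(X, Y)`, seen as a set of natural numbers. -/
def codePair {r : ℕ} (X : ℕ → Fin 3) (Y : Fin r → ℕ → Fin 2) : Set ℕ :=
  codeSet {p : ℕ × (Fin 3 × (Fin r → Fin 2)) | p.2 = (X p.1, fun s => Y s p.1)}

/-- The two pairs `(X i, Y i)`, `i < 2`, form a solution to the instance `T` of the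
cross-constraint problem. -/
structure IsCCSolution {r : ℕ} (T : Set (Node r)) (X : Fin 2 → ℕ → Fin 3)
    (Y : Fin 2 → Fin r → ℕ → Fin 2) : Prop where
  path : ∀ i, IsPath T (X i) (Y i)
  left : FinitelyCompatible (X 0) (X 1)
  right : ∀ s, ¬ FinitelyCompatible (Y 0 s) (Y 1 s)

/-- A cross-constraint ideal, for `r`-tuples of binary strings on the right: a Turing ideal in
which every left-full cross-tree of the ideal has a solution. -/
structure IsCrossConstraintIdeal (r : ℕ) (M : Set (Set ℕ)) : Prop extends IsTuringIdeal M where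
  solution : ∀ T : Set (Node r), IsCrossTree T → LeftFull T → codeSet T ∈ M →
    ∃ X Y, IsCCSolution T X Y ∧ join (codePair (X 0) (Y 0)) (codePair (X 1) (Y 1)) ∈ M

/-! ### Cohesiveness -/

/-- `C` is an infinite set which is cohesive for the sequence `R`. -/
def IsCohesive (R : ℕ → Set ℕ) (C : Set ℕ) : Prop :=
  C.Infinite ∧ ∀ n, (C \ R n).Finite ∨ (C \ (R n)ᶜ).Finite

/-- `M ⊨ COH`: every sequence of sets in `M` has an infinite cohesive set in `M`. -/
def ModelsCOH (M : Set (Set ℕ)) : Prop :=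
  ∀ R : ℕ → Set ℕ, codeSet {p : ℕ × ℕ | p.2 ∈ R p.1} ∈ M → ∃ C ∈ M, IsCohesive R C

/-! ### Hyperimmune colorings -/

/-- `f` is hyperimmune relative to `D`. A `D`-computable array of `k`-tuples of finite sets is
given by a `D`-computable sequence of `k`-tuples of lists, `F n j` listing the elements of the
`j`-th set of the `n`-th tuple. -/
def HyperimmuneRel {k : ℕ} (f : ℕ → Fin k) (D : Set ℕ) : Prop :=
  ∀ F : ℕ → Fin k → List ℕ, ComputableFrom D F →
    (∀ n i j, i ≠ j → (F n i).Disjoint (F n j)) →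
    (∀ n j, ∀ x ∈ F n j, n < x) →
    ∃ N, ∀ j, ∀ x ∈ F N j, f x = j

/-! ### Colorings of integers and of pairs, homogeneous sets -/

/-- The set `[ℕ]²` of two-element sets of integers, as increasing pairs. -/
abbrev IncPair : Type := {p : ℕ × ℕ // p.1 < p.2}

/-- A coloring of pairs, seen as a set of natural numbers. -/
def codeColoring (g : IncPair → Fin 2) : Set ℕ :=
  codeSet {q : (ℕ × ℕ) × Fin 2 | ∃ h : q.1.1 < q.1.2, g ⟨q.1, h⟩ = q.2}

/-- `H` is homogeneous for the coloring `f` of integers. -/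
def Homogeneous₁ {k : ℕ} (f : ℕ → Fin k) (H : Set ℕ) : Prop := ∃ c, ∀ x ∈ H, f x = c

/-- `H` is homogeneous for the coloring `g` of pairs. -/
def Homogeneous₂ {k : ℕ} (g : IncPair → Fin k) (H : Set ℕ) : Prop :=
  ∃ c, ∀ x ∈ H, ∀ y ∈ H, ∀ h : x < y, g ⟨(x, y), h⟩ = c

end CrossConstraint

namespace CrossConstraint

open Encodable Part

/-! ### Closure properties of functions computable from oracles. -/

section Relative

variable {α β γ σ : Type} [Primcodable α] [Primcodable β] [Primcodable γ] [Primcodable σ]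
variable {O : Set (ℕ →. ℕ)}

/-! `COH` reduces the colorings to stable ones (`exists_stable`): on an infinite base set in `M`,
each `γ s x y` is eventually a limit color `lim s x`. Either the base can be chosen so that the
limit color is constant, or both limit colors occur in every infinite subset of the base that lies
in `M`. Hence two sets with labels `0` and `1` can be built for each `s` with limit colors
prescribed by `lam s`; in the constant case both labels carry the same color.

These `2 * r` sets are built by Mathias forcing with reservoirs in `M`. One set must then be chosen
for each `s`, so the requirements are disjunctive: given a functional and a color of `f` for each
choice `i` of labels, some `i` has its functional enumerate a finite set or a number of the wrong
color. If every choice failed, picking a bad functional for each would violate one such requirement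
(`exists_avoiding`).

A requirement is forced in `Cond.exists_forcing`. The limit colors need not be available in `M`, so
they are replaced by an arbitrary guess `Y`, while `X` stands for a guess at `f`. A finite extension
that makes the functional accept `n` is an obstacle: if `Y` agrees with its labels, then `X n` must
be the associated color. For each `N`, the obstacles with `n > N` define a cross-tree in `M`.

If one of these trees is left-full, it has two paths in `M` as in the cross-constraint principle.
Infinite compatibility on the right lets each reservoir be thinned to positions where both `Y` take
a common label `i s`. A number above `N` enumerated for `i` then forces both `X` to the same color,
which happens only finitely often. If no tree is left-full, compactness yields computably in `D` a
ternary string for each `N` that no `Y` can accompany; hyperimmunity makes one such string agree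
with `f` above `N`. Taking for `Y` the true limit colors gives an extension that enumerates a number
of the wrong color (`exists_solution_or_meets`). -/

theorem RecursiveIn.comp_computable {f : β →. σ} {g : α → β} (hf : RecursiveIn O f)
    (hg : ComputableIn O g) : RecursiveIn O fun a => f (g a) :=
  (Nat.RecursiveIn.comp hf hg).of_eq fun n => by
    simp only [map_some, bind_eq_bind]
    rcases e : decode (α := α) n with - | a <;> simp [encodek]

theorem ComputableIn.comp {f : β → σ} {g : α → β} (hf : ComputableIn O f)
    (hg : ComputableIn O g) : ComputableIn O fun a => f (g a) :=
  RecursiveIn.comp_computable (f := fun b => Part.some (f b)) hf hg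

theorem ComputableIn.pair {f : α → β} {g : α → γ} (hf : ComputableIn O f)
    (hg : ComputableIn O g) : ComputableIn O fun a => (f a, g a) :=
  (Nat.RecursiveIn.pair hf hg).of_eq fun n => by
    rcases e : decode (α := α) n <;> simp [Seq.seq]

theorem ComputableIn.nat_rec {f : α → ℕ} {g : α → σ} {h : α → ℕ × σ → σ}
    (hf : ComputableIn O f) (hg : ComputableIn O g) (hh : ComputableIn₂ O h) :
    ComputableIn O fun a =>
      Nat.rec (motive := fun _ => σ) (g a) (fun y IH => h a (y, IH)) (f a) := by
  have key : Nat.RecursiveIn O _ :=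
    Nat.RecursiveIn.comp (Nat.RecursiveIn.prec hg hh)
      (Nat.RecursiveIn.pair (Nat.Partrec.some.recursiveIn) hf)
  refine Nat.RecursiveIn.of_eq key fun n => ?_
  rcases e : decode (α := α) n with - | a
  · simp [Seq.seq]
  · simp [Seq.seq, e]
    induction f a <;> simp_all

theorem RecursiveIn.rfind {p : α → ℕ → Bool} (hp : ComputableIn₂ O p) :
    RecursiveIn O fun a => Nat.rfind (fun n => (p a n : Part Bool)) := by
  have h0 : ComputableIn O fun q : α × ℕ => cond (p q.1 q.2) 0 1 :=
    ComputableIn.comp (f := fun b : Bool => cond b 0 1)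
      (Primrec.dom_bool fun b => cond b 0 1).computableIn hp
  refine (Nat.RecursiveIn.rfind h0).of_eq fun n => ?_
  rcases e : decode (α := α) n with - | a
  · exact (Nat.rfind_zero_none _ (by simp [e])).trans (by simp)
  · simp only [coe_some, bind_some, map_some, Part.map_eq_map, encode_nat]
    have h1 : ∀ b : Bool, decide ((bif b then 0 else 1) = 0) = b := by decide
    simp [e, h1, map_id']

end Relative

/-! ### Predicates decidable from an oracle, and searches. -/

section Decidable

variable {α β γ : Type} [Primcodable α] [Primcodable β] [Primcodable γ] {D : Set ℕ}

theorem ComputableFrom.of_primrec {f : α → β} (hf : Primrec f) : ComputableFrom D f :=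
  hf.computableIn

theorem ComputableFrom.comp {f : β → γ} {g : α → β} (hf : ComputableFrom D f)
    (hg : ComputableFrom D g) : ComputableFrom D fun a => f (g a) :=
  ComputableIn.comp hf hg

theorem ComputableFrom.pair {f : α → β} {g : α → γ} (hf : ComputableFrom D f)
    (hg : ComputableFrom D g) : ComputableFrom D fun a => (f a, g a) :=
  ComputableIn.pair hf hg

/-- The predicate `P` is decidable relative to `D`. -/
def DecidableFrom (D : Set ℕ) (P : α → Prop) : Prop :=
  ∃ b : α → Bool, ComputableFrom D b ∧ ∀ a, b a = true ↔ P a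

theorem DecidableFrom.of_primrec {P : α → Prop} (hP : PrimrecPred P) : DecidableFrom D P := by
  obtain ⟨_, h⟩ := hP
  exact ⟨_, h.computableIn, fun a => by simp⟩

theorem DecidableFrom.of_iff {P Q : α → Prop} (hP : DecidableFrom D P) (h : ∀ a, Q a ↔ P a) :
    DecidableFrom D Q := by
  rwa [show Q = P from funext fun a => propext (h a)]

theorem DecidableFrom.const (p : Prop) : DecidableFrom D fun _ : α => p := by
  classical exact ⟨fun _ => decide p, ComputableIn.const _, fun a => by simp⟩

theorem DecidableFrom.comp {P : β → Prop} {f : α → β} (hP : DecidableFrom D P)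
    (hf : ComputableFrom D f) : DecidableFrom D fun a => P (f a) := by
  obtain ⟨b, hb, h⟩ := hP
  exact ⟨_, hb.comp hf, fun a => h _⟩

theorem DecidableFrom.not {P : α → Prop} (hP : DecidableFrom D P) :
    DecidableFrom D fun a => ¬ P a := by
  obtain ⟨b, hb, h⟩ := hP
  exact ⟨_, .comp (.of_primrec (Primrec.dom_bool Bool.not)) hb, fun a => by simp [← h]⟩

theorem DecidableFrom.and {P Q : α → Prop} (hP : DecidableFrom D P) (hQ : DecidableFrom D Q) :
    DecidableFrom D fun a => P a ∧ Q a := by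
  obtain ⟨b, hb, h⟩ := hP
  obtain ⟨c, hc, k⟩ := hQ
  exact ⟨fun a => b a && c a, .comp (f := fun p : Bool × Bool => p.1 && p.2)
    (.of_primrec Primrec.and) (hb.pair hc), fun a => by simp [← h, ← k]⟩

theorem DecidableFrom.or {P Q : α → Prop} (hP : DecidableFrom D P) (hQ : DecidableFrom D Q) :
    DecidableFrom D fun a => P a ∨ Q a :=
  (hP.not.and hQ.not).not.of_iff fun a => by tauto

theorem DecidableFrom.imp {P Q : α → Prop} (hP : DecidableFrom D P) (hQ : DecidableFrom D Q) :
    DecidableFrom D fun a => P a → Q a :=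
  (hP.not.or hQ).of_iff fun a => by tauto

theorem DecidableFrom.iff {P Q : α → Prop} (hP : DecidableFrom D P) (hQ : DecidableFrom D Q) :
    DecidableFrom D fun a => P a ↔ Q a :=
  ((hP.imp hQ).and (hQ.imp hP)).of_iff fun a => by tauto

theorem DecidableFrom.eq {f g : α → β} (hf : ComputableFrom D f) (hg : ComputableFrom D g) :
    DecidableFrom D fun a => f a = g a :=
  letI := decidableEqOfEncodable β
  DecidableFrom.comp (P := fun p : β × β => p.1 = p.2)
    (.of_primrec (Primrec.eq (α := β))) (hf.pair hg)

theorem DecidableFrom.lt {f g : α → ℕ} (hf : ComputableFrom D f) (hg : ComputableFrom D g) :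
    DecidableFrom D fun a => f a < g a :=
  DecidableFrom.comp (P := fun p : ℕ × ℕ => p.1 < p.2) (.of_primrec Primrec.nat_lt) (hf.pair hg)

theorem DecidableFrom.forall_mem {P : α → β → Prop} {l : α → List β}
    (hl : ComputableFrom D l) (hP : DecidableFrom D fun p : α × β => P p.1 p.2) :
    DecidableFrom D fun a => ∀ b ∈ l a, P a b := by
  obtain ⟨c, hc, h⟩ := hP
  cases isEmpty_or_nonempty β with
  | inl hβ => exact (DecidableFrom.const True).of_iff fun a => by simp
  | inr hβ =>
    obtain ⟨b₀⟩ := hβ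
    -- The bounded quantifier is a recursion along the length of the list. The default `b₀` only
    -- makes the lookup total; the recursion never reaches an index out of range.
    have hget : ComputableFrom D fun q : α × ℕ × Bool => (l q.1)[q.2.1]?.getD b₀ :=
      .comp (f := fun p : List β × ℕ => p.1[p.2]?.getD b₀)
        (.of_primrec (Primrec.option_getD.comp Primrec.list_getElem? (.const b₀)))
        (.pair (hl.comp (.of_primrec .fst)) (.of_primrec (Primrec.fst.comp .snd)))
    have hstep : ComputableFrom D fun q : α × ℕ × Bool =>
        (q.2.2 && c (q.1, (l q.1)[q.2.1]?.getD b₀)) :=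
      .comp (f := fun p : Bool × Bool => p.1 && p.2) (.of_primrec Primrec.and)
        (.pair (.of_primrec (Primrec.snd.comp .snd)) (hc.comp (.pair (.of_primrec .fst) hget)))
    refine ⟨_, ComputableIn.nat_rec (O := {charFun D}) (f := fun a => (l a).length)
      (g := fun _ => true) (h := fun a p => p.2 && c (a, (l a)[p.1]?.getD b₀))
      (ComputableFrom.comp (.of_primrec Primrec.list_length) hl)
      (ComputableIn.const true) hstep, fun a => ?_⟩
    have key : ∀ n, Nat.rec (motive := fun _ => Bool) true
        (fun y IH => IH && c (a, (l a)[y]?.getD b₀)) n = true ↔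
        ∀ k < n, P a ((l a)[k]?.getD b₀) := by
      intro n
      induction n with
      | zero => simp
      | succ n ih =>
        simp only [Bool.and_eq_true, ih, h]
        exact Nat.forall_lt_succ_right.symm
    change _ ↔ ∀ b ∈ l a, P a b
    rw [key, List.forall_mem_iff_getElem]
    refine forall₂_congr fun k hk => ?_
    simp [List.getElem?_eq_getElem hk]

theorem DecidableFrom.exists_mem {P : α → β → Prop} {l : α → List β}
    (hl : ComputableFrom D l) (hP : DecidableFrom D fun p : α × β => P p.1 p.2) :
    DecidableFrom D fun a => ∃ b ∈ l a, P a b :=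
  (DecidableFrom.forall_mem hl (P := fun a b => ¬ P a b) hP.not).not.of_iff fun a => by
    push Not; rfl

theorem DecidableFrom.exists_search {R : α → ℕ → Prop}
    (hR : DecidableFrom D fun p : α × ℕ => R p.1 p.2) (h : ∀ a, ∃ n, R a n) :
    ∃ s : α → ℕ, ComputableFrom D s ∧ ∀ a, R a (s a) := by
  classical
  obtain ⟨b, hb, hbR⟩ := hR
  refine ⟨fun a => Nat.find (h a), ?_, fun a => Nat.find_spec (h a)⟩
  refine RecursiveIn.of_eq (RecursiveIn.rfind (p := fun a n => b (a, n)) hb) fun a => ?_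
  refine Part.eq_some_iff.2 (Nat.mem_rfind.2 ⟨?_, fun {m} hm => ?_⟩)
  · exact Part.mem_some_iff.2 ((hbR (a, _)).2 (Nat.find_spec (h a))).symm
  · exact Part.mem_some_iff.2 (Bool.eq_false_iff.2 (mt (hbR (a, m)).1 (Nat.find_min (h a) hm))).symm

theorem charFun_mem {A : Set ℕ} {b : ℕ → Bool} (h : ∀ n, b n = true ↔ n ∈ A) :
    charFun A = fun n => Part.some (cond (b n) 1 0) := by
  funext n
  simp only [charFun]
  by_cases hn : n ∈ A
  · rw [(h n).2 hn]; simp [hn]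
  · rw [Bool.eq_false_iff.2 (mt (h n).1 hn)]; simp [hn]

theorem decidableFrom_mem {A : Set ℕ} : DecidableFrom D (· ∈ A) ↔ Computes D A := by
  constructor
  · rintro ⟨b, hb, h⟩
    rw [Computes, charFun_mem h]
    exact ComputableIn.comp (f := fun b : Bool => cond b 1 0)
      (Primrec.dom_bool fun b => cond b 1 0).computableIn hb
  · intro h
    classical
    refine DecidableFrom.of_iff (P := fun n => (if n ∈ A then 1 else 0) = 1)
      (.eq (f := fun n => if n ∈ A then 1 else 0) ?_ (ComputableIn.const 1)) fun a => by simp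
    exact h

/-- A predicate on finite objects is decidable from `D` if and only if `D` computes the set of
codes of its elements. -/
theorem computes_codeSet_iff {P : α → Prop} :
    Computes D (codeSet {a | P a}) ↔ DecidableFrom D P := by
  rw [← decidableFrom_mem]
  constructor
  · intro h
    refine (h.comp (.of_primrec (Primrec.encode (α := α)))).of_iff fun a => ?_
    simp [codeSet]
  · intro h
    -- `decode₂` rejects numbers that are not genuine codes, which `decode` might accept.
    refine DecidableFrom.of_iff (P := fun n => ∃ a ∈ (decode₂ α n).toList, P a)
      (.exists_mem (.of_primrec (Primrec.optionToList.comp Primrec.decode₂))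
        (h.comp (.of_primrec .snd))) fun n => ?_
    simp [codeSet, decode₂_eq_some, and_comm]

theorem ComputableFrom.trans {E : Set ℕ} {f : α → β} (hf : ComputableFrom D f)
    (h : Computes E D) : ComputableFrom E f :=
  _root_.RecursiveIn.subst hf (by simpa [Computes] using h)

theorem DecidableFrom.trans {E : Set ℕ} {P : α → Prop} (hP : DecidableFrom D P)
    (h : Computes E D) : DecidableFrom E P := by
  obtain ⟨b, hb, hP⟩ := hP
  exact ⟨b, hb.trans h, hP⟩

theorem DecidableFrom.self : DecidableFrom D (· ∈ D) :=
  decidableFrom_mem.2 (TuringReducible.refl _)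

theorem computes_join_left (A B : Set ℕ) : Computes (join A B) A :=
  decidableFrom_mem.1 <| (DecidableFrom.self.comp (.of_primrec Primrec.nat_double)).of_iff
    fun n => by simp [join]; omega

theorem computes_join_right (A B : Set ℕ) : Computes (join A B) B :=
  decidableFrom_mem.1 <| (DecidableFrom.self.comp (.of_primrec Primrec.nat_double_succ)).of_iff
    fun n => by simp [join]; omega

/-- Every infinite set has a subset enumerated increasingly by a function computable from it. -/
theorem exists_strictMono_of_infinite {Q : ℕ → Prop} (hQ : DecidableFrom D Q)
    (hinf : {n | Q n}.Infinite) :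
    ∃ q : ℕ → ℕ, StrictMono q ∧ (∀ n, Q (q n)) ∧ ComputableFrom D q := by
  obtain ⟨s, hs, h⟩ := DecidableFrom.exists_search (D := D)
    (R := fun m n => m < n ∧ Q n)
    (.and (.lt (.of_primrec .fst) (.of_primrec .snd)) (hQ.comp (.of_primrec .snd)))
    fun m => by
      obtain ⟨n, hn, hm⟩ := hinf.exists_gt m
      exact ⟨n, hm, hn⟩
  refine ⟨fun n => Nat.rec (motive := fun _ => ℕ) (s 0) (fun _ x => s x) n,
    strictMono_nat_of_lt_succ fun n => (h _).1, fun n => ?_, ?_⟩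
  · cases n <;> exact (h _).2
  · exact ComputableIn.nat_rec (O := {charFun D}) (f := fun n => n) (h := fun _ p => s p.2)
      ComputableIn.id (ComputableIn.const _)
      (ComputableFrom.comp hs (.of_primrec (Primrec.snd.comp .snd)))

end Decidable

end CrossConstraint

/-! ### The use principle: oracle computations through finite initial segments. -/

namespace CrossConstraint

open Encodable Part

open Classical in
/-- The initial segment of length `k` of the characteristic sequence of `G`. -/
noncomputable def initSeg (G : Set ℕ) (k : ℕ) : List Bool :=
  (List.range k).map fun n => decide (n ∈ G)

theorem initSeg_prefix (G : Set ℕ) {k l : ℕ} (h : k ≤ l) : initSeg G k <+: initSeg G l := by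
  obtain ⟨m, rfl⟩ := Nat.exists_eq_add_of_le h
  rw [initSeg, initSeg, List.range_add, List.map_append]
  exact List.prefix_append _ _

theorem initSeg_getElem? (G : Set ℕ) {k n : ℕ} (h : n < k) [Decidable (n ∈ G)] :
    (initSeg G k)[n]? = Option.some (decide (n ∈ G)) := by
  simp [initSeg, h]

theorem initSeg_length (G : Set ℕ) (k : ℕ) : (initSeg G k).length = k := by simp [initSeg]

/-- The partial function `p`, which takes a finite oracle as an additional argument, gives
the function `h` when the finite oracles are initial segments of `G`. -/
structure Approximates (G : Set ℕ) (p : List Bool → ℕ → Part ℕ) (h : ℕ → Part ℕ) : Prop where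
  partrec : Partrec₂ (p : List Bool → ℕ →. ℕ)
  mono : ∀ {τ τ' n m}, τ <+: τ' → m ∈ p τ n → m ∈ p τ' n
  mem_iff : ∀ n m, m ∈ h n ↔ ∃ k, m ∈ p (initSeg G k) n

namespace Approximates

variable {G : Set ℕ} {p q : List Bool → ℕ → Part ℕ} {f h : ℕ → Part ℕ}

theorem mono_initSeg (hp : Approximates G p h) {k l n m : ℕ} (hkl : k ≤ l)
    (hm : m ∈ p (initSeg G k) n) : m ∈ p (initSeg G l) n :=
  hp.mono (initSeg_prefix G hkl) hm

theorem of_partrec (hh : Nat.Partrec (h : ℕ →. ℕ)) : Approximates G (fun _ => h) h where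
  partrec := (Partrec.nat_iff.2 hh).comp Computable.snd
  mono _ hm := hm
  mem_iff _ _ := by simp

/-- A query beyond the end of the finite oracle diverges, so lengthening the oracle never changes an
answer already given. -/
theorem oracle (G : Set ℕ) :
    Approximates G (fun τ n => ((τ[n]?.map fun b => cond b 1 0 : Option ℕ) : Part ℕ))
      (charFun G) where
  partrec := Computable.ofOption <| Primrec.to_comp <|
    Primrec.option_map Primrec.list_getElem?
      ((Primrec.dom_bool fun b => cond b 1 0).comp Primrec.snd).to₂
  mono {τ τ' n m} hτ hm := by
    obtain ⟨ρ, rfl⟩ := hτ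
    simp only [mem_coe, Option.mem_def, Option.map_eq_some_iff] at hm ⊢
    obtain ⟨b, hb, h⟩ := hm
    refine ⟨b, ?_, h⟩
    rw [List.getElem?_append_left (List.getElem?_eq_some_iff.1 hb).1, hb]
  mem_iff n m := by
    classical
    simp only [charFun, mem_some_iff, mem_coe, Option.mem_def, Option.map_eq_some_iff]
    constructor
    · rintro rfl
      refine ⟨n + 1, decide (n ∈ G), initSeg_getElem? G (Nat.lt_succ_self n), ?_⟩
      by_cases hn : n ∈ G <;> simp [hn]
    · rintro ⟨k, b, hb, rfl⟩
      have hk : n < k := by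
        simpa [initSeg_length] using (List.getElem?_eq_some_iff.1 hb).1
      rw [initSeg_getElem? G hk] at hb
      by_cases hn : n ∈ G <;> simp_all

theorem pair (hp : Approximates G p f) (hq : Approximates G q h) :
    Approximates G (fun τ n => Nat.pair <$> p τ n <*> q τ n)
      (fun n => Nat.pair <$> f n <*> h n) where
  partrec := by
    have := Partrec.bind (f := fun a : List Bool × ℕ => p a.1 a.2) hp.partrec
      (g := fun a b => (q a.1 a.2).map (Nat.pair b)) (Partrec.map (hq.partrec.comp (Computable.fst.comp .fst) (Computable.snd.comp .fst))
        (f := fun a : (List Bool × ℕ) × ℕ => q a.1.1 a.1.2) (g := fun a m => Nat.pair a.2 m)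
        (Primrec₂.natPair.comp (Primrec.snd.comp .fst) .snd).to_comp)
    exact Partrec.of_eq this fun a => by simp [Seq.seq]
  mono hτ hm := by
    simp only [Seq.seq, mem_bind_iff, mem_map_iff, Part.map_eq_map] at hm ⊢
    obtain ⟨_, ⟨a, ha, rfl⟩, b, hb, rfl⟩ := hm
    exact ⟨_, ⟨a, hp.mono hτ ha, rfl⟩, b, hq.mono hτ hb, rfl⟩
  mem_iff n m := by
    simp only [Seq.seq, mem_bind_iff, mem_map_iff, Part.map_eq_map, hp.mem_iff, hq.mem_iff]
    constructor
    · rintro ⟨_, ⟨a, ⟨k, ha⟩, rfl⟩, b, ⟨l, hb⟩, rfl⟩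
      exact ⟨max k l, _, ⟨a, hp.mono_initSeg (le_max_left _ _) ha, rfl⟩, b,
        hq.mono_initSeg (le_max_right _ _) hb, rfl⟩
    · rintro ⟨k, _, ⟨a, ha, rfl⟩, b, hb, rfl⟩
      exact ⟨_, ⟨a, ⟨k, ha⟩, rfl⟩, b, ⟨k, hb⟩, rfl⟩

theorem comp (hp : Approximates G p f) (hq : Approximates G q h) :
    Approximates G (fun τ n => q τ n >>= p τ) (fun n => h n >>= f) where
  partrec := Partrec.bind hq.partrec
    (hp.partrec.comp (Computable.fst.comp .fst) Computable.snd)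
  mono hτ hm := by
    simp only [Part.bind_eq_bind, mem_bind_iff] at hm ⊢
    obtain ⟨a, ha, hb⟩ := hm
    exact ⟨a, hq.mono hτ ha, hp.mono hτ hb⟩
  mem_iff n m := by
    simp only [Part.bind_eq_bind, mem_bind_iff, hp.mem_iff, hq.mem_iff]
    constructor
    · rintro ⟨a, ⟨k, ha⟩, l, hb⟩
      exact ⟨max k l, a, hq.mono_initSeg (le_max_left _ _) ha,
        hp.mono_initSeg (le_max_right _ _) hb⟩
    · rintro ⟨k, a, ha, hb⟩
      exact ⟨a, ⟨k, ha⟩, k, hb⟩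

theorem prec_mono (hp : Approximates G p f) (hq : Approximates G q h) {τ τ' : List Bool}
    (hτ : τ <+: τ') (a n m : ℕ)
    (hm : m ∈ Nat.rec (motive := fun _ => Part ℕ) (p τ a) (fun y IH => IH.bind fun i =>
      q τ (Nat.pair a (Nat.pair y i))) n) :
    m ∈ Nat.rec (motive := fun _ => Part ℕ) (p τ' a) (fun y IH => IH.bind fun i =>
      q τ' (Nat.pair a (Nat.pair y i))) n := by
  induction n generalizing m with
  | zero => exact hp.mono hτ hm
  | succ n ih =>
    simp only [mem_bind_iff] at hm ⊢
    obtain ⟨i, hi, hm⟩ := hm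
    exact ⟨i, ih _ hi, hq.mono hτ hm⟩

theorem prec (hp : Approximates G p f) (hq : Approximates G q h) :
    Approximates G
      (fun τ x => Nat.rec (motive := fun _ => Part ℕ) (p τ x.unpair.1) (fun y IH => IH.bind fun i =>
        q τ (Nat.pair x.unpair.1 (Nat.pair y i))) x.unpair.2)
      (fun x => Nat.rec (motive := fun _ => Part ℕ) (f x.unpair.1) (fun y IH => IH.bind fun i =>
        h (Nat.pair x.unpair.1 (Nat.pair y i))) x.unpair.2) where
  partrec := by
    have hu : Computable fun a : List Bool × ℕ => a.2.unpair := Computable.unpair.comp .snd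
    exact Partrec.nat_rec (f := fun a : List Bool × ℕ => a.2.unpair.2)
      (g := fun a => p a.1 a.2.unpair.1)
      (h := fun a b => q a.1 (Nat.pair a.2.unpair.1 (Nat.pair b.1 b.2)))
      (Computable.snd.comp hu) (hp.partrec.comp .fst (Computable.fst.comp hu))
      (hq.partrec.comp (Computable.fst.comp .fst)
        (Primrec₂.natPair.to_comp.comp (Computable.fst.comp (hu.comp .fst))
          (Primrec₂.natPair.to_comp.comp (Computable.fst.comp .snd)
            (Computable.snd.comp .snd))))
  mono {τ τ' x m} hτ hm := hp.prec_mono hq hτ x.unpair.1 x.unpair.2 m hm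
  mem_iff x m := by
    generalize x.unpair.1 = a, x.unpair.2 = n
    induction n generalizing m with
    | zero => exact hp.mem_iff _ _
    | succ n ih =>
      simp only [mem_bind_iff, ih, hq.mem_iff]
      constructor
      · rintro ⟨i, ⟨k, hk⟩, l, hl⟩
        exact ⟨max k l, i, hp.prec_mono hq (initSeg_prefix G (le_max_left _ _)) _ _ _ hk,
          hq.mono_initSeg (le_max_right _ _) hl⟩
      · rintro ⟨k, i, hk, hl⟩
        exact ⟨i, ⟨k, hk⟩, k, hl⟩

theorem rfind (hp : Approximates G p f) :
    Approximates G (fun τ a => Nat.rfind fun n => (fun m => m = 0) <$> p τ (Nat.pair a n))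
      (fun a => Nat.rfind fun n => (fun m => m = 0) <$> f (Nat.pair a n)) where
  partrec := by
    refine Partrec.rfind (p := fun (a : List Bool × ℕ) n =>
      (p a.1 (Nat.pair a.2 n)).map fun m => decide (m = 0)) ?_
    exact Partrec.map (hp.partrec.comp (Computable.fst.comp .fst)
      (Primrec₂.natPair.to_comp.comp (Computable.snd.comp .fst) .snd))
      (Primrec.eq.comp (Primrec.snd) (Primrec.const 0)).decide.to_comp
  mono hτ hm := by
    refine Nat.mem_rfind.2 ⟨?_, fun {j} hj => ?_⟩
    · obtain ⟨a, ha, h⟩ := (mem_map_iff _).1 (Nat.mem_rfind.1 hm).1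
      exact (mem_map_iff _).2 ⟨a, hp.mono hτ ha, h⟩
    · obtain ⟨a, ha, h⟩ := (mem_map_iff _).1 ((Nat.mem_rfind.1 hm).2 hj)
      exact (mem_map_iff _).2 ⟨a, hp.mono hτ ha, h⟩
  mem_iff x m := by
    constructor
    · intro hm
      obtain ⟨h0, h1⟩ := Nat.mem_rfind.1 hm
      obtain ⟨a, ha, ha0⟩ := (mem_map_iff _).1 h0
      obtain ⟨k, hk⟩ := (hp.mem_iff _ _).1 ha
      have h2 : ∀ j : ℕ, ∃ l, j < m →
          false ∈ (fun m : ℕ => decide (m = 0)) <$> p (initSeg G l) (Nat.pair x j) := by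
        intro j
        by_cases hj : j < m
        · obtain ⟨b, hb, hb0⟩ := (mem_map_iff _).1 (h1 hj)
          obtain ⟨l, hl⟩ := (hp.mem_iff _ _).1 hb
          exact ⟨l, fun _ => (mem_map_iff _).2 ⟨b, hl, hb0⟩⟩
        · exact ⟨0, fun h => absurd h hj⟩
      choose l hl using h2
      -- A successful search makes only finitely many evaluations, so one initial segment serves
      -- them all.
      refine ⟨max k ((Finset.range m).sup l), Nat.mem_rfind.2 ⟨?_, fun {j} hj => ?_⟩⟩
      · exact (mem_map_iff _).2 ⟨a, hp.mono_initSeg (le_max_left _ _) hk, ha0⟩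
      · obtain ⟨b, hb, hb0⟩ := (mem_map_iff _).1 (hl j hj)
        exact (mem_map_iff _).2 ⟨b, hp.mono_initSeg ((Finset.le_sup (f := l)
          (Finset.mem_range.2 hj)).trans (le_max_right _ _)) hb, hb0⟩
    · rintro ⟨k, hk⟩
      refine Nat.mem_rfind.2 ⟨?_, fun {j} hj => ?_⟩
      · obtain ⟨a, ha, h⟩ := (mem_map_iff _).1 (Nat.mem_rfind.1 hk).1
        exact (mem_map_iff _).2 ⟨a, (hp.mem_iff _ _).2 ⟨k, ha⟩, h⟩
      · obtain ⟨a, ha, h⟩ := (mem_map_iff _).1 ((Nat.mem_rfind.1 hk).2 hj)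
        exact (mem_map_iff _).2 ⟨a, (hp.mem_iff _ _).2 ⟨k, ha⟩, h⟩

end Approximates

/-- The use principle, by induction on the relative computation: a halting computation queries a
finite part of the oracle. -/
theorem exists_approximates {G : Set ℕ} {h : ℕ →. ℕ} (hh : Nat.RecursiveIn {charFun G} h) :
    ∃ p, Approximates G p h := by
  induction hh with
  | zero => exact ⟨_, .of_partrec .zero⟩
  | succ => exact ⟨_, .of_partrec .succ⟩
  | left => exact ⟨_, .of_partrec .left⟩
  | right => exact ⟨_, .of_partrec .right⟩
  | oracle g hg => obtain rfl := hg; exact ⟨_, .oracle G⟩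
  | pair _ _ ihf ihg =>
    obtain ⟨p, hp⟩ := ihf
    obtain ⟨q, hq⟩ := ihg
    exact ⟨_, hp.pair hq⟩
  | comp _ _ ihf ihg =>
    obtain ⟨p, hp⟩ := ihf
    obtain ⟨q, hq⟩ := ihg
    exact ⟨_, hp.comp hq⟩
  | prec _ _ ihf ihg =>
    obtain ⟨p, hp⟩ := ihf
    obtain ⟨q, hq⟩ := ihg
    exact ⟨_, hp.prec hq⟩
  | rfind _ ih =>
    obtain ⟨p, hp⟩ := ih
    exact ⟨_, hp.rfind⟩

/-- The computation of the functional `c` with finite oracle `τ` on the input `n` accepts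
within `t` steps. -/
def Accepts (c : Nat.Partrec.Code) (τ : List Bool) (n t : ℕ) : Prop :=
  c.evaln t (encode (τ, n)) = Option.some 1

/-- The set enumerated by the functional `c` with oracle `G`. -/
def enumSet (c : Nat.Partrec.Code) (G : Set ℕ) : Set ℕ :=
  {n | ∃ k t, Accepts c (initSeg G k) n t}

/-- Only the answers `1` are kept. The construction thus has to handle enumerations only, indexed by
the countable type of codes. -/
theorem exists_enumSet_eq {G H : Set ℕ} (h : Computes G H) : ∃ c, enumSet c G = H := by
  obtain ⟨p, hp⟩ := exists_approximates (_root_.RecursiveIn.iff_nat.1 h)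
  obtain ⟨c, hc⟩ := Nat.Partrec.Code.exists_code.1 hp.partrec
  refine ⟨c, Set.ext fun n => ?_⟩
  have h1 : n ∈ H ↔ 1 ∈ charFun H n := by
    by_cases hn : n ∈ H <;> simp [charFun, hn]
  rw [h1, hp.mem_iff]
  refine exists_congr fun k => ?_
  have h2 := Nat.Partrec.Code.evaln_complete (c := c) (n := encode (initSeg G k, n)) (x := 1)
  rw [hc] at h2
  simpa [Accepts] using h2.symm

end CrossConstraint

/-! ### Compactness, and cross-trees defined by obstacles. -/

namespace CrossConstraint

open Encodable

/-! ### Strings of length `n` -/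

theorem restrict_getElem? {k : ℕ} (X : ℕ → Fin k) {m n : ℕ} (h : m < n) :
    (restrict X n)[m]? = some (X m) := by
  simp [restrict, h]

theorem restrict_length {k : ℕ} (X : ℕ → Fin k) (n : ℕ) : (restrict X n).length = n := by
  simp [restrict]

theorem restrict_prefix {k : ℕ} (X : ℕ → Fin k) {m n : ℕ} (h : m ≤ n) :
    restrict X m <+: restrict X n := by
  obtain ⟨l, rfl⟩ := Nat.exists_eq_add_of_le h
  rw [restrict, restrict, List.range_add, List.map_append]
  exact List.prefix_append _ _

theorem restrict_getD {k : ℕ} (l : List (Fin (k + 1))) :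
    restrict (fun n => l[n]?.getD 0) l.length = l := by
  refine List.ext_getElem? fun m => ?_
  by_cases hm : m < l.length
  · rw [restrict_getElem? _ hm, List.getElem?_eq_getElem hm]; rfl
  · rw [List.getElem?_eq_none (by simpa [restrict] using hm), List.getElem?_eq_none (by simpa using hm)]

theorem getElem?_of_prefix {α : Type} {l l' : List α} (h : l <+: l') {n : ℕ} {a : α}
    (hn : l[n]? = some a) : l'[n]? = some a := by
  obtain ⟨t, rfl⟩ := h
  rw [List.getElem?_append_left (List.getElem?_eq_some_iff.1 hn).1, hn]

/-- All `r`-tuples of binary strings of length `n`. -/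
noncomputable def allTuples (r n : ℕ) : List (Fin r → List (Fin 2)) :=
  Nat.rec [fun _ => []] (fun _ L => L.flatMap fun σ =>
    (Finset.univ : Finset (Fin r → Fin 2)).toList.map fun b s => b s :: σ s) n

theorem mem_allTuples {r n : ℕ} {σ : Fin r → List (Fin 2)} :
    σ ∈ allTuples r n ↔ ∀ s, (σ s).length = n := by
  induction n generalizing σ with
  | zero => simp [allTuples, funext_iff]
  | succ n ih =>
    have h : allTuples r (n + 1) = (allTuples r n).flatMap fun σ =>
      (Finset.univ : Finset (Fin r → Fin 2)).toList.map fun b s => b s :: σ s := rfl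
    rw [h]
    simp only [List.mem_flatMap, ih, List.mem_map, Finset.mem_toList, Finset.mem_univ, true_and]
    constructor
    · rintro ⟨σ, hσ, b, rfl⟩ s
      simp [hσ s]
    · intro hσ
      have h0 : ∀ s, σ s ≠ [] := fun s h => by simpa [h] using hσ s
      refine ⟨fun s => (σ s).tail, fun s => by simp [hσ s], fun s => (σ s).head (h0 s), ?_⟩
      funext s
      simp

theorem primrec_allTuples (r : ℕ) : Primrec (allTuples r) := by
  have h1 : Primrec fun q : (Fin r → List (Fin 2)) × (Fin r → Fin 2) =>
      fun s => q.2 s :: q.1 s :=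
    Primrec.fin_curry.2 <| Primrec.list_cons.comp
      (Primrec.fin_app.comp (Primrec.snd.comp .fst) .snd)
      (Primrec.fin_app.comp (Primrec.fst.comp .fst) .snd)
  have h2 : Primrec fun σ : Fin r → List (Fin 2) =>
      (Finset.univ : Finset (Fin r → Fin 2)).toList.map fun b s => b s :: σ s :=
    Primrec.list_map (.const _) h1
  have h3 : Primrec₂ fun (_ : ℕ) (L : List (Fin r → List (Fin 2))) => L.flatMap fun σ =>
      (Finset.univ : Finset (Fin r → Fin 2)).toList.map fun b s => b s :: σ s :=
    Primrec.list_flatMap .snd (h2.comp .snd)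
  exact Primrec.nat_rec₁ _ h3

/-! ### Compactness -/

/-- Compactness of `(2^ℕ)^r`: the sets of `Y` compatible with `X` up to level `n` are closed and
decreasing, so if all were nonempty they would have a common point. -/
theorem exists_level_of_not_path {r : ℕ} {T : Set (Node r)} (hT : IsCrossTree T)
    {X : ℕ → Fin 3} (hX : ∀ Y, ¬ IsPath T X Y) :
    ∃ n, ∀ σ ∈ allTuples r n, ((restrict X n, σ) : Node r) ∉ T := by
  by_contra! hcon
  let K : ℕ → Set (Fin r → ℕ → Fin 2) := fun n =>
    {Y | ((restrict X n, fun s => restrict (Y s) n) : Node r) ∈ T}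
  have hanti : ∀ n, K (n + 1) ⊆ K n := fun n Y hY =>
    hT.downward _ hY _ ⟨fun i j => by simp [restrict], fun i => by simp [restrict]⟩
      ⟨restrict_prefix _ n.le_succ, fun i => restrict_prefix _ n.le_succ⟩
  have hne : ∀ n, (K n).Nonempty := fun n => by
    obtain ⟨σ, hσ, h⟩ := hcon n
    refine ⟨fun s m => (σ s)[m]?.getD 0, ?_⟩
    have h1 : (fun s => restrict (fun m => (σ s)[m]?.getD 0) n) = σ := funext fun s => by
      conv_lhs => rw [← mem_allTuples.1 hσ s]
      exact restrict_getD _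
    change (_, _) ∈ T
    rwa [h1]
  have hclosed : ∀ n, IsClosed (K n) := fun n => by
    let φ : (Fin r → ℕ → Fin 2) → Fin r → Fin n → Fin 2 := fun Y s m => Y s m
    have hφ : Continuous φ := by fun_prop
    -- Membership in `K n` depends only on the first `n` values of each component, so `K n` is the
    -- preimage of a subset of a finite discrete space.
    have h1 : K n = φ ⁻¹' (φ '' K n) := by
      refine (Set.subset_preimage_image _ _).antisymm ?_
      rintro Y ⟨Y', hY', hφY⟩
      have h2 : (fun s => restrict (Y s) n) = fun s => restrict (Y' s) n := funext fun s =>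
        List.map_congr_left fun m hm =>
          (congrFun (congrFun hφY s) ⟨m, List.mem_range.1 hm⟩).symm
      change (_, _) ∈ T
      rw [h2]
      exact hY'
    rw [h1]
    exact (Set.toFinite _).isClosed.preimage hφ
  obtain ⟨Y, hY⟩ := IsCompact.nonempty_iInter_of_sequence_nonempty_isCompact_isClosed K hanti hne
    (hclosed 0).isCompact hclosed
  exact hX Y fun n => Set.mem_iInter.1 hY n

/-! ### The tree avoiding obstacles -/

section Obstacles

/-- A decidable family of obstacles: an obstacle `w` with `V w` forbids the pairs `(X, Y)` such
that `Y` extends the finite partial function listed by `part w`, unless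
`X (num w) = col w`. -/
structure Obstacles (r : ℕ) (D : Set ℕ) (β : Type) [Primcodable β] where
  V : β → Prop
  num : β → ℕ
  col : β → Fin 3
  part : β → List (Fin r × ℕ × Fin 2)
  decidable_V : DecidableFrom D V
  computable_num : Primrec num
  computable_col : Primrec col
  computable_part : Primrec part

variable {r : ℕ} {D : Set ℕ} {β : Type} [Primcodable β]

namespace Obstacles

/-- The obstacles with code less than `n`. -/
def stage (β : Type) [Primcodable β] (n : ℕ) : List β := (List.range n).filterMap decode

theorem primrec_stage : Primrec (stage β) :=
  Primrec.listFilterMap Primrec.list_range (Primrec.decode.comp .snd)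

theorem mem_stage {w : β} {n : ℕ} (h : encode w < n) : w ∈ stage β n :=
  List.mem_filterMap.2 ⟨encode w, List.mem_range.2 h, encodek w⟩

theorem stage_mono {n m : ℕ} (h : n ≤ m) {w : β} (hw : w ∈ stage β n) : w ∈ stage β m := by
  obtain ⟨k, hk, h'⟩ := List.mem_filterMap.1 hw
  exact List.mem_filterMap.2 ⟨k, List.mem_range.2 ((List.mem_range.1 hk).trans_le h), h'⟩

variable (Q : Obstacles r D β)

/-- The pairs of strings which meet no obstacle about a number greater than `N`. -/
def tree (N : ℕ) : Set (Node r) :=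
  {χ | χ.Admissible ∧ ∀ w ∈ stage β χ.1.length, Q.V w → N < Q.num w →
    (∀ u ∈ Q.part w, (χ.2 u.1)[u.2.1]? = some u.2.2) →
    χ.1[Q.num w]? = none ∨ χ.1[Q.num w]? = some (Q.col w)}

/-- Shortening a node leaves fewer obstacles to examine and fewer of them matched on the right, and
an undefined value on the left is allowed. -/
theorem isCrossTree_tree (N : ℕ) : IsCrossTree (Q.tree N) where
  admissible _ h := h.1
  downward ψ hψ χ hχ hp := by
    refine ⟨hχ, fun w hw hV hN hu => ?_⟩
    have h := hψ.2 w (stage_mono hp.1.length_le hw) hV hN fun u hu' =>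
      getElem?_of_prefix (hp.2 _) (hu u hu')
    cases hc : χ.1[Q.num w]? with
    | none => exact .inl rfl
    | some v =>
      rw [getElem?_of_prefix hp.1 hc] at h
      simpa using h

theorem decidable_admissible : DecidableFrom D (Node.Admissible (r := r)) := by
  have hlen : Primrec fun p : Node r × Fin r => (p.1.2 p.2).length :=
    Primrec.list_length.comp (Primrec.fin_app.comp (Primrec.snd.comp .fst) .snd)
  have h1 : DecidableFrom D fun χ : Node r => ∀ i ∈ List.finRange r, ∀ j ∈ List.finRange r,
      (χ.2 i).length = (χ.2 j).length :=
    .forall_mem (.of_primrec (.const _)) (.forall_mem (.of_primrec (.const _))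
      (.eq (.of_primrec (hlen.comp .fst))
        (.of_primrec (hlen.comp ((Primrec.fst.comp .fst).pair .snd)))))
  have h2 : DecidableFrom D fun χ : Node r => ∀ i ∈ List.finRange r,
      ¬ χ.1.length < (χ.2 i).length :=
    .forall_mem (.of_primrec (.const _)) (.not (.lt
      (.of_primrec (Primrec.list_length.comp (Primrec.fst.comp .fst))) (.of_primrec hlen)))
  exact (h1.and h2).of_iff fun χ => by simp [Node.Admissible]

theorem decidable_tree : DecidableFrom D fun p : ℕ × Node r => p.2 ∈ Q.tree p.1 := by
  have hnum : Primrec fun p : (ℕ × Node r) × β => p.1.2.1[Q.num p.2]? :=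
    Primrec.list_getElem?.comp (Primrec.fst.comp (Primrec.snd.comp .fst))
      (Q.computable_num.comp .snd)
  refine .and (decidable_admissible.comp (.of_primrec .snd)) (.forall_mem
    (.of_primrec (primrec_stage.comp (Primrec.list_length.comp (Primrec.fst.comp .snd))))
    (.imp (Q.decidable_V.comp (.of_primrec .snd)) (.imp (.lt (.of_primrec (Primrec.fst.comp .fst))
      (.of_primrec (Q.computable_num.comp .snd))) (.imp (.forall_mem
        (.of_primrec (Q.computable_part.comp .snd)) (.eq (.of_primrec ?_) (.of_primrec ?_)))
        (.or (.eq (.of_primrec hnum) (.of_primrec (.const _)))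
          (.eq (.of_primrec hnum) (.of_primrec
            (Primrec.option_some.comp (Q.computable_col.comp .snd)))))))))
  · exact Primrec.list_getElem?.comp (Primrec.fin_app.comp
      (Primrec.snd.comp (Primrec.snd.comp (Primrec.fst.comp .fst))) (Primrec.fst.comp .snd))
      (Primrec.fst.comp (Primrec.snd.comp .snd))
  · exact Primrec.option_some.comp (Primrec.snd.comp (Primrec.snd.comp .snd))

theorem eq_col_of_isPath {N : ℕ} {X : ℕ → Fin 3} {Y : Fin r → ℕ → Fin 2}
    (h : IsPath (Q.tree N) X Y) {w : β} (hV : Q.V w) (hN : N < Q.num w)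
    (hu : ∀ u ∈ Q.part w, Y u.1 u.2.1 = u.2.2) : X (Q.num w) = Q.col w := by
  obtain ⟨m, hm⟩ : ∃ m, ∀ u ∈ Q.part w, u.2.1 < m :=
    ⟨((Q.part w).map fun u => u.2.1).sum + 1, fun u hu => Nat.lt_succ_of_le
      (List.le_sum_of_mem (List.mem_map_of_mem hu))⟩
  -- This level is large enough for `w` to be examined, for `X (num w)` to be defined, and for every
  -- position in `part w` to be decided.
  have h1 := (h (encode w + Q.num w + m + 1)).2 w
    (mem_stage (by simp only [restrict_length]; omega)) hV hN fun u hu' => by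
      rw [restrict_getElem? _ (by have := hm u hu'; omega), hu u hu']
  rw [restrict_getElem? _ (by omega)] at h1
  simpa using h1

/-- Either some tree of pairs avoiding obstacles has a solution in the ideal, or a hyperimmune
coloring meets some obstacle, together with any given sequence of sets. -/
theorem exists_solution_or_meets {M : Set (Set ℕ)} (hM : IsCrossConstraintIdeal r M)
    (hD : D ∈ M) {f : ℕ → Fin 3} (hf : HyperimmuneRel f D) :
    (∃ N X Y, IsCCSolution (Q.tree N) X Y ∧
      join (codePair (X 0) (Y 0)) (codePair (X 1) (Y 1)) ∈ M) ∨
    ∀ Y : Fin r → ℕ → Fin 2, ∃ w, Q.V w ∧ (∀ u ∈ Q.part w, Y u.1 u.2.1 = u.2.2) ∧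
      f (Q.num w) ≠ Q.col w := by
  by_cases hfull : ∃ N, LeftFull (Q.tree N)
  · obtain ⟨N, hN⟩ := hfull
    obtain ⟨X, Y, h⟩ := hM.solution _ (Q.isCrossTree_tree N) hN (hM.downward _ hD _
      (computes_codeSet_iff.2 (Q.decidable_tree.comp
        (.of_primrec ((Primrec.const N).pair .id)))))
    exact .inl ⟨N, X, Y, h⟩
  right
  -- The failure of left-fullness is witnessed by one finite string, with finitely many `σ` to
  -- check, so it can be found by a search relative to `D`. Numbers that decode to nothing are read
  -- as the empty string.
  have hsearch : ∀ N, ∃ v, ∀ σ ∈ allTuples r ((decode v : Option (List (Fin 3))).getD []).length,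
      (((decode v : Option (List (Fin 3))).getD [], σ) : Node r) ∉ Q.tree N := by
    intro N
    have h1 : ∃ X, ∀ Y, ¬ IsPath (Q.tree N) X Y := by
      by_contra! hcon
      exact hfull ⟨N, hcon⟩
    obtain ⟨X, hX⟩ := h1
    obtain ⟨n, hn⟩ := exists_level_of_not_path (Q.isCrossTree_tree N) hX
    refine ⟨encode (restrict X n), ?_⟩
    simpa [encodek, restrict_length] using hn
  have hdec : Primrec fun v => (decode v : Option (List (Fin 3))).getD [] :=
    Primrec.option_getD.comp .decode (.const _)
  obtain ⟨c, hc, hcN⟩ := DecidableFrom.exists_search (D := D) (α := ℕ) (.forall_mem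
    (.of_primrec ((primrec_allTuples r).comp (Primrec.list_length.comp (hdec.comp .snd))))
    (Q.decidable_tree.comp (.of_primrec ((Primrec.fst.comp .fst).pair
      ((hdec.comp (Primrec.snd.comp .fst)).pair .snd)))).not) hsearch
  let ρ : ℕ → List (Fin 3) := fun N => (decode (c N) : Option (List (Fin 3))).getD []
  -- The color classes of `ρ N` above `N`: the conclusion of hyperimmunity for this array is that
  -- `f` agrees with some `ρ N` above `N`.
  let F : ℕ → Fin 3 → List ℕ := fun N j => (List.range (ρ N).length).filterMap fun x =>
    if N < x ∧ (ρ N)[x]? = some j then some x else none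
  have hmem : ∀ N j x, x ∈ F N j ↔ N < x ∧ (ρ N)[x]? = some j := by
    intro N j x
    simp only [F, List.mem_filterMap, List.mem_range, Option.ite_none_right_eq_some]
    constructor
    · rintro ⟨a, -, h, ha⟩
      obtain rfl := Option.some.inj ha
      exact h
    · exact fun h => ⟨x, (List.getElem?_eq_some_iff.1 h.2).1, h, rfl⟩
  have hF : ComputableFrom D F := by
    have h1 : Primrec fun q : ℕ × List (Fin 3) => fun j : Fin 3 =>
        (List.range q.2.length).filterMap fun x =>
          if q.1 < x ∧ q.2[x]? = some j then some x else none := by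
      refine Primrec.fin_curry.2 (Primrec.listFilterMap
        (Primrec.list_range.comp (Primrec.list_length.comp (Primrec.snd.comp .fst)))
        (Primrec.ite (PrimrecPred.and ?_ ?_) (Primrec.option_some.comp .snd) (.const _)))
      · exact Primrec.nat_lt.comp (Primrec.fst.comp (Primrec.fst.comp .fst)) .snd
      · exact Primrec.eq.comp (Primrec.list_getElem?.comp
          (Primrec.snd.comp (Primrec.fst.comp .fst)) .snd)
          (Primrec.option_some.comp (Primrec.snd.comp .fst))
    exact .comp (.of_primrec h1) (.pair (.of_primrec .id) (.comp (.of_primrec hdec) hc))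
  obtain ⟨N, hN⟩ := hf F hF
    (fun n i j hij x hi hj => hij (by
      have := ((hmem n i x).1 hi).2.symm.trans ((hmem n j x).1 hj).2
      simpa using this))
    (fun n j x hx => ((hmem n j x).1 hx).1)
  intro Y
  -- Every `Y`, cut to the length of `ρ N`, leaves the tree. The node is admissible, so an obstacle
  -- is responsible, and its number lies in the range where `ρ N` agrees with `f`.
  have h1 := hcN N (fun s => restrict (Y s) (ρ N).length)
    (mem_allTuples.2 fun s => restrict_length _ _)
  change ((ρ N, _) : Node r) ∉ _ at h1
  have hadm : Node.Admissible ((ρ N, fun s => restrict (Y s) (ρ N).length) : Node r) :=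
    ⟨fun i j => by simp [restrict_length], fun i => by simp [restrict_length]⟩
  simp only [tree, Set.mem_ofPred_eq, hadm, true_and, not_forall, not_or] at h1
  obtain ⟨w, -, hV, hNw, hu, hne, hcol⟩ := h1
  refine ⟨w, hV, fun u hu' => ?_, fun hfw => ?_⟩
  · have h2 := hu u hu'
    have h3 : u.2.1 < (ρ N).length := by
      simpa [restrict_length] using (List.getElem?_eq_some_iff.1 h2).1
    rw [restrict_getElem? _ h3] at h2
    exact Option.some.inj h2
  · obtain ⟨v, hv⟩ := Option.ne_none_iff_exists'.1 hne
    rw [hv] at hcol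
    have h4 := hN v _ ((hmem N v _).2 ⟨hNw, hv⟩)
    exact hcol (by rw [← h4, hfw])

end Obstacles

end Obstacles

end CrossConstraint

/-! ### Forcing conditions for stable colorings. -/

namespace CrossConstraint

open Encodable

section Families

variable {α : Type} [Primcodable α] {D : Set ℕ}

theorem DecidableFrom.exists_fintype {ι : Type} [Fintype ι] {P : ι → α → Prop}
    (h : ∀ i, DecidableFrom D (P i)) : DecidableFrom D fun a => ∃ i, P i a := by
  classical
  have key : ∀ S : Finset ι, DecidableFrom D fun a => ∃ i ∈ S, P i a := by
    intro S
    induction S using Finset.induction_on with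
    | empty => exact (DecidableFrom.const False).of_iff fun a => by simp
    | insert i S _ ih => exact ((h i).or ih).of_iff fun a => by simp
  exact (key Finset.univ).of_iff fun a => by simp

theorem DecidableFrom.uniform {r : ℕ} {P : Fin r → α → Prop}
    (h : ∀ s, DecidableFrom D (P s)) : DecidableFrom D fun q : Fin r × α => P q.1 q.2 :=
  (DecidableFrom.exists_fintype (P := fun s (q : Fin r × α) => q.1 = s ∧ P s q.2) fun s =>
    (DecidableFrom.eq (.of_primrec .fst) (.of_primrec (.const s))).and
      ((h s).comp (.of_primrec .snd))).of_iff fun q => by simp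

/-- Finitely many oracles in the ideal are bounded by their join, so a single `D` serves all `s`. -/
theorem IsTuringIdeal.exists_bound {M : Set (Set ℕ)} (hM : IsTuringIdeal M) {r : ℕ}
    {A : Fin r → Set ℕ → Prop} (hA : ∀ s D E, Computes E D → A s D → A s E)
    (h : ∀ s, ∃ D ∈ M, A s D) : ∃ D ∈ M, ∀ s, A s D := by
  have key : ∀ S : Finset (Fin r), ∃ D ∈ M, ∀ s ∈ S, A s D := by
    intro S
    induction S using Finset.induction_on with
    | empty => obtain ⟨D, hD⟩ := hM.nonempty; exact ⟨D, hD, by simp⟩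
    | insert i S _ ih =>
      obtain ⟨D, hD, h1⟩ := ih
      obtain ⟨E, hE, h2⟩ := h i
      refine ⟨_, hM.join_mem _ hD _ hE, fun s hs => ?_⟩
      rcases Finset.mem_insert.1 hs with rfl | hs
      · exact hA _ _ _ (computes_join_right D E) h2
      · exact hA _ _ _ (computes_join_left D E) (h1 s hs)
  obtain ⟨D, hD, h⟩ := key Finset.univ
  exact ⟨D, hD, fun s => h s (Finset.mem_univ s)⟩

theorem decidable_codePair {r : ℕ} (X : ℕ → Fin 3) (Y : Fin r → ℕ → Fin 2) (s : Fin r)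
    (b : Fin 2) : DecidableFrom (codePair X Y) fun n => Y s n = b := by
  have h := computes_codeSet_iff.1 (TuringReducible.refl (charFun (codePair X Y)))
  refine (DecidableFrom.exists_fintype (ι := Fin 3 × (Fin r → Fin 2))
    (P := fun v n => (v = (X n, fun s => Y s n)) ∧ v.2 s = b) fun v =>
      (h.comp (.of_primrec (Primrec.id.pair (.const v)))).and (.const _)).of_iff fun n => ?_
  simp

end Families

/-- Colorings of pairs with their limits on a base reservoir for each of them. The sets to be
constructed are indexed by labels, and `lam` gives the color of the homogeneous set with a
given label. -/
structure StableFamily (r : ℕ) (M : Set (Set ℕ)) where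
  γ : Fin r → ℕ → ℕ → Fin 2
  base : Fin r → Set ℕ
  lim : Fin r → ℕ → Fin 2
  lam : Fin r → Fin 2 → Fin 2
  computable_γ : ∀ s, ∃ D ∈ M, ComputableFrom D fun p : ℕ × ℕ => γ s p.1 p.2
  finite_ne_lim : ∀ s, ∀ x ∈ base s, {y ∈ base s | γ s x y ≠ lim s x}.Finite
  lam_lim : ∀ s, ∀ x ∈ base s, lam s (lim s x) = lim s x
  exists_lim_eq : ∀ s k (p : ℕ → ℕ), StrictMono p → (∀ n, p n ∈ base s) →
    (∃ D ∈ M, ComputableFrom D p) → ∃ n, lim s (p n) = lam s k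

namespace StableFamily

variable {r : ℕ} {M : Set (Set ℕ)} (S : StableFamily r M)

/-- The forcing conditions: finite approximations of the sets under construction, and
reservoirs in `M`. -/
structure Cond where
  F : Fin r → Fin 2 → Set ℕ
  p : Fin r → ℕ → ℕ
  finite : ∀ s k, (F s k).Finite
  mono : ∀ s, StrictMono (p s)
  computable : ∀ s, ∃ D ∈ M, ComputableFrom D (p s)
  mem_base : ∀ s n, p s n ∈ S.base s
  hom : ∀ s k, ∀ x ∈ F s k, ∀ y ∈ F s k, x < y → S.γ s x y = S.lam s k
  hom_reservoir : ∀ s k, ∀ x ∈ F s k, ∀ n, x < p s n ∧ S.γ s x (p s n) = S.lam s k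

/-- The sets `G s k` are homogeneous, extend the finite sets of the condition, and their
other elements are in the reservoirs. -/
structure Follows (G : Fin r → Fin 2 → Set ℕ) (c : S.Cond) : Prop where
  subset : ∀ s k, c.F s k ⊆ G s k
  subset_union : ∀ s k, G s k ⊆ c.F s k ∪ Set.range (c.p s)
  hom : ∀ s k, ∀ x ∈ G s k, ∀ y ∈ G s k, x < y → S.γ s x y = S.lam s k

/-- The condition `d` extends `c`. -/
structure Extends (d c : S.Cond) : Prop where
  subset : ∀ s k, c.F s k ⊆ d.F s k
  subset_union : ∀ s k, d.F s k ⊆ c.F s k ∪ Set.range (c.p s)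
  range_subset : ∀ s, Set.range (d.p s) ⊆ Set.range (c.p s)

variable {S}

theorem Extends.refl (c : S.Cond) : S.Extends c c where
  subset _ _ := subset_rfl
  subset_union _ _ := Set.subset_union_left
  range_subset _ := subset_rfl

theorem Extends.trans {c d e : S.Cond} (h : S.Extends e d) (h' : S.Extends d c) :
    S.Extends e c where
  subset s k := (h'.subset s k).trans (h.subset s k)
  subset_union s k := (h.subset_union s k).trans <| Set.union_subset (h'.subset_union s k) <|
    (h'.range_subset s).trans Set.subset_union_right
  range_subset s := (h.range_subset s).trans (h'.range_subset s)

theorem computable_shift {p : ℕ → ℕ} (h : ∃ D ∈ M, ComputableFrom D p) (m : ℕ) :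
    ∃ D ∈ M, ComputableFrom D fun n => p (n + m) := by
  obtain ⟨D, hD, hp⟩ := h
  exact ⟨D, hD, hp.comp (.of_primrec (Primrec.nat_add.comp .id (.const m)))⟩

/-- Each element of `A` has its limit color with all but finitely many elements of the base, and `A`
is finite. -/
theorem Cond.exists_tail (c : S.Cond) (s : Fin r) {A : Set ℕ} (hA : A.Finite)
    (hbase : A ⊆ S.base s) (b : ℕ) :
    ∃ m, ∀ n, b < c.p s (n + m) ∧ ∀ x ∈ A, x < c.p s (n + m) ∧
      S.γ s x (c.p s (n + m)) = S.lim s x := by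
  have h1 : ∀ᶠ n in Filter.atTop, b < c.p s n :=
    (c.mono s).tendsto_atTop.eventually_gt_atTop b
  have h2 : ∀ x ∈ A, ∀ᶠ n in Filter.atTop, x < c.p s n ∧ S.γ s x (c.p s n) = S.lim s x := by
    intro x hx
    refine ((c.mono s).tendsto_atTop.eventually_gt_atTop x).and ?_
    have h3 := (S.finite_ne_lim s x (hbase hx)).preimage (c.mono s).injective.injOn
    have h4 := h3.eventually_cofinite_notMem
    rw [Nat.cofinite_eq_atTop] at h4
    filter_upwards [h4] with n hn
    by_contra hne
    exact hn ⟨c.mem_base s n, hne⟩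
  obtain ⟨m, hm⟩ := Filter.eventually_atTop.1 (h1.and ((Filter.eventually_all_finite hA).2 h2))
  exact ⟨m, fun n => hm _ (Nat.le_add_left m n)⟩

/-- Elements of the reservoirs with the right limits can be added to a condition. -/
theorem Cond.exists_add (c : S.Cond) {E : Fin r → Fin 2 → Set ℕ} (hfin : ∀ s k, (E s k).Finite)
    (hE : ∀ s k, E s k ⊆ Set.range (c.p s)) (hlim : ∀ s k, ∀ x ∈ E s k, S.lim s x = S.lam s k)
    (hhom : ∀ s k, ∀ x ∈ E s k, ∀ y ∈ E s k, x < y → S.γ s x y = S.lam s k) (b : ℕ) :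
    ∃ d : S.Cond, S.Extends d c ∧ (∀ s k, d.F s k = c.F s k ∪ E s k) ∧ ∀ s n, b < d.p s n := by
  have hbase : ∀ s k, E s k ⊆ S.base s := fun s k x hx => by
    obtain ⟨n, rfl⟩ := hE s k hx
    exact c.mem_base s n
  choose m hm using fun s => c.exists_tail s (A := ⋃ k, E s k)
    (Set.finite_iUnion fun k => hfin s k) (Set.iUnion_subset fun k => hbase s k) b
  refine ⟨{
    F := fun s k => c.F s k ∪ E s k
    p := fun s n => c.p s (n + m s)
    finite := fun s k => (c.finite s k).union (hfin s k)
    mono := fun s => (c.mono s).comp (strictMono_id.add_const (m s))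
    computable := fun s => computable_shift (c.computable s) (m s)
    mem_base := fun s n => c.mem_base s _
    hom := ?_
    hom_reservoir := ?_ }, ⟨?_, ?_, ?_⟩, fun _ _ => rfl, fun s n => (hm s n).1⟩
  · rintro s k x (hx | hx) y (hy | hy) hxy
    · exact c.hom s k x hx y hy hxy
    · obtain ⟨n, rfl⟩ := hE s k hy
      exact (c.hom_reservoir s k x hx n).2
    · obtain ⟨n, rfl⟩ := hE s k hx
      exact absurd hxy (c.hom_reservoir s k y hy n).1.not_gt
    · exact hhom s k x hx y hy hxy
  · rintro s k x (hx | hx) n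
    · exact c.hom_reservoir s k x hx _
    · obtain ⟨h1, h2⟩ := (hm s n).2 x (Set.mem_iUnion.2 ⟨k, hx⟩)
      exact ⟨h1, h2.trans (hlim s k x hx)⟩
  · exact fun s k => Set.subset_union_left
  · exact fun s k => Set.union_subset_union_right _ (hE s k)
  · rintro s _ ⟨n, rfl⟩
    exact ⟨_, rfl⟩

/-- Density for infinitude: a tail of the reservoir is still in the ideal, so it contains an element
whose limit color suits label `k`. The shift by `b + 1` puts this element above `b`. -/
theorem Cond.exists_gt (c : S.Cond) (s : Fin r) (k : Fin 2) (b : ℕ) :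
    ∃ d : S.Cond, S.Extends d c ∧ ∃ x ∈ d.F s k, b < x := by
  obtain ⟨n, hn⟩ := S.exists_lim_eq s k (fun n => c.p s (n + (b + 1)))
    ((c.mono s).comp (strictMono_id.add_const (b + 1))) (fun n => c.mem_base s _)
    (computable_shift (c.computable s) _)
  obtain ⟨d, hd, hF, -⟩ := c.exists_add
    (E := fun s' k' => {x | s' = s ∧ k' = k ∧ x = c.p s (n + (b + 1))})
    (fun s' k' => (Set.finite_singleton _).subset fun x hx => hx.2.2)
    (by rintro _ k' _ ⟨rfl, rfl, rfl⟩; exact ⟨_, rfl⟩)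
    (by rintro _ _ _ ⟨rfl, rfl, rfl⟩; exact hn)
    (by rintro _ _ _ ⟨rfl, rfl, rfl⟩ _ ⟨-, -, rfl⟩ h; exact absurd h (lt_irrefl _)) 0
  refine ⟨d, hd, c.p s (n + (b + 1)), ?_, ?_⟩
  · rw [hF]
    exact .inr ⟨rfl, rfl, rfl⟩
  · have := (c.mono s).le_apply (x := n + (b + 1))
    omega

end StableFamily

end CrossConstraint

/-! ### Finite extensions as obstacles, and the forcing of one requirement. -/

namespace CrossConstraint

open Encodable

theorem mem_finJoin {r : ℕ} {G : Fin r → Set ℕ} {z : ℕ} :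
    z ∈ finJoin G ↔ ∃ s, ∃ x ∈ G s, encode (s, x) = z := by
  simp [finJoin, codeSet]

theorem le_encode_pair {r : ℕ} (s : Fin r) (x : ℕ) : x ≤ encode (s, x) := by
  rw [encode_prod_val]
  exact Nat.right_le_pair _ _

theorem eq_initSeg {τ : List Bool} {G : Set ℕ}
    (h : ∀ z < τ.length, τ[z]? = some true ↔ z ∈ G) : τ = initSeg G τ.length := by
  classical
  refine List.ext_getElem? fun z => ?_
  by_cases hz : z < τ.length
  · have := h z hz
    rw [initSeg_getElem? G hz]
    rw [List.getElem?_eq_getElem hz] at this ⊢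
    cases hb : τ[z] <;> simp_all
  · rw [List.getElem?_eq_none (by omega), List.getElem?_eq_none (by rw [initSeg_length]; omega)]

theorem initSeg_getElem?_eq_true {G : Set ℕ} {k z : ℕ} (h : z < k) :
    (initSeg G k)[z]? = some true ↔ z ∈ G := by
  classical
  rw [initSeg_getElem? G h]
  simp

theorem finite_finJoin {r : ℕ} {G : Fin r → Set ℕ} (h : ∀ s, (G s).Finite) :
    (finJoin G).Finite := by
  refine Set.Finite.image _ ?_
  refine (Set.finite_iUnion fun s => (h s).image (Prod.mk s)).subset ?_
  rintro ⟨s, x⟩ hx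
  exact Set.mem_iUnion.2 ⟨s, x, hx, rfl⟩

namespace StableFamily

variable {r : ℕ} {M : Set (Set ℕ)} {S : StableFamily r M}

/-- A tuple of labels, a finite set of new elements with their positions in the reservoirs,
a finite oracle, an input and a number of steps. -/
abbrev Witness (r : ℕ) : Type :=
  (Fin r → Fin 2) × List (Fin r × ℕ × ℕ) × List Bool × ℕ × ℕ

/-- The witness shows that the functional associated to its labels accepts its input when the
new elements are added to the condition. -/
structure Valid (c : S.Cond) (C : (Fin r → Fin 2) → Nat.Partrec.Code × Fin 3) (w : Witness r) :
    Prop where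
  accepts : Accepts (C w.1).1 w.2.2.1 w.2.2.2.1 w.2.2.2.2
  eq_p : ∀ u ∈ w.2.1, u.2.2 = c.p u.1 u.2.1
  hom : ∀ u ∈ w.2.1, ∀ v ∈ w.2.1, u.1 = v.1 → u.2.2 < v.2.2 →
    S.γ u.1 u.2.2 v.2.2 = S.lam u.1 (w.1 u.1)
  oracle : ∀ z < w.2.2.1.length, w.2.2.1[z]? = some true ↔
    z ∈ finJoin (fun s => c.F s (w.1 s)) ∨ ∃ u ∈ w.2.1, z = encode (u.1, u.2.2)

theorem decidable_accepts {D : Set ℕ} (C : (Fin r → Fin 2) → Nat.Partrec.Code × Fin 3) :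
    DecidableFrom D fun w : Witness r => Accepts (C w.1).1 w.2.2.1 w.2.2.2.1 w.2.2.2.2 := by
  have h1 : Primrec fun w : Witness r => w.2.2 := Primrec.snd.comp .snd
  have h2 : Primrec fun w : Witness r => (C w.1).1 :=
    (Primrec.dom_finite fun i => (C i).1).comp .fst
  refine .eq (.of_primrec (Nat.Partrec.Code.primrec_evaln.comp
    (((Primrec.snd.comp (Primrec.snd.comp h1)).pair h2).pair (Primrec.encode.comp
      ((Primrec.fst.comp h1).pair (Primrec.fst.comp (Primrec.snd.comp h1)))))))
    (.of_primrec (.const _))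

/-- Validity does not mention limit colors, which need not be computable from `D`. It uses only the
colorings, the reservoirs and the finite sets of the condition. -/
theorem decidable_valid {D : Set ℕ} (c : S.Cond)
    (C : (Fin r → Fin 2) → Nat.Partrec.Code × Fin 3)
    (hp : ∀ s, ComputableFrom D (c.p s))
    (hγ : ∀ s, ComputableFrom D fun p : ℕ × ℕ => S.γ s p.1 p.2) :
    DecidableFrom D (Valid c C) := by
  have hE : Primrec fun w : Witness r => w.2.1 := Primrec.fst.comp .snd
  have hτ : Primrec fun w : Witness r => w.2.2.1 := Primrec.fst.comp (Primrec.snd.comp .snd)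
  have h1 : DecidableFrom D fun w : Witness r => ∀ u ∈ w.2.1, u.2.2 = c.p u.1 u.2.1 := by
    have h := DecidableFrom.uniform (D := D) (P := fun s (q : ℕ × ℕ) => q.2 = c.p s q.1) fun s =>
      .eq (.of_primrec .snd) ((hp s).comp (.of_primrec .fst))
    exact .forall_mem (.of_primrec hE) (h.comp (.of_primrec .snd))
  have h2 : DecidableFrom D fun w : Witness r => ∀ u ∈ w.2.1, ∀ v ∈ w.2.1, u.1 = v.1 →
      u.2.2 < v.2.2 → S.γ u.1 u.2.2 v.2.2 = S.lam u.1 (w.1 u.1) := by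
    have h := DecidableFrom.uniform (D := D)
      (P := fun s (q : Fin 2 × ℕ × ℕ) => S.γ s q.2.1 q.2.2 = S.lam s q.1) fun s =>
      .eq ((hγ s).comp (.of_primrec .snd))
        (.of_primrec ((Primrec.dom_finite (S.lam s)).comp .fst))
    have hu : Primrec fun q : (Witness r × (Fin r × ℕ × ℕ)) × (Fin r × ℕ × ℕ) => q.1.2 :=
      Primrec.snd.comp .fst
    refine .forall_mem (.of_primrec hE) (.forall_mem (.of_primrec (hE.comp .fst)) (.imp
      (.eq (.of_primrec (Primrec.fst.comp hu)) (.of_primrec (Primrec.fst.comp .snd)))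
      (.imp (.lt (.of_primrec (Primrec.snd.comp (Primrec.snd.comp hu)))
        (.of_primrec (Primrec.snd.comp (Primrec.snd.comp .snd))))
      (h.comp (.of_primrec (f := fun q : (Witness r × (Fin r × ℕ × ℕ)) × (Fin r × ℕ × ℕ) =>
        (q.1.2.1, q.1.1.1 q.1.2.1, q.1.2.2.2, q.2.2.2)) ?_)))))
    exact (Primrec.fst.comp hu).pair ((Primrec.fin_app.comp
      (Primrec.fst.comp (Primrec.fst.comp .fst)) (Primrec.fst.comp hu)).pair
      ((Primrec.snd.comp (Primrec.snd.comp hu)).pair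
        (Primrec.snd.comp (Primrec.snd.comp .snd))))
  have h3 : DecidableFrom D fun w : Witness r => ∀ z ∈ List.range w.2.2.1.length,
      w.2.2.1[z]? = some true ↔
      (∃ y ∈ (finite_finJoin fun s => c.finite s (w.1 s)).toFinset.toList, z = y) ∨
        ∃ u ∈ w.2.1, z = encode (u.1, u.2.2) := by
    refine .forall_mem (.of_primrec (Primrec.list_range.comp (Primrec.list_length.comp hτ)))
      (.iff (.eq (.of_primrec (Primrec.list_getElem?.comp (hτ.comp .fst) .snd))
        (.of_primrec (.const _))) (.or (.exists_mem (.of_primrec ?_)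
          (.eq (.of_primrec (Primrec.snd.comp .fst)) (.of_primrec .snd)))
        (.exists_mem (.of_primrec (hE.comp .fst))
          (.eq (.of_primrec (Primrec.snd.comp .fst)) (.of_primrec ?_)))))
    · exact (Primrec.dom_finite fun i : Fin r → Fin 2 =>
        (finite_finJoin fun s => c.finite s (i s)).toFinset.toList).comp
          (Primrec.fst.comp .fst)
    · exact Primrec.encode.comp ((Primrec.fst.comp .snd).pair
        (Primrec.snd.comp (Primrec.snd.comp .snd)))
  refine ((decidable_accepts C).and (h1.and (h2.and h3))).of_iff fun w =>
    ⟨fun h => ⟨h.accepts, h.eq_p, h.hom, ?_⟩, fun h => ⟨h.1, h.2.1, h.2.2.1, ?_⟩⟩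
  · simpa using h.oracle
  · simpa using h.2.2.2

/-- The obstacles given by the valid witnesses. -/
def obstacles {D : Set ℕ} (c : S.Cond) (C : (Fin r → Fin 2) → Nat.Partrec.Code × Fin 3)
    (hV : DecidableFrom D (Valid c C)) : Obstacles r D (Witness r) where
  V := Valid c C
  num w := w.2.2.2.1
  col w := (C w.1).2
  part w := w.2.1.map fun u => (u.1, u.2.1, w.1 u.1)
  decidable_V := hV
  computable_num := Primrec.fst.comp (Primrec.snd.comp (Primrec.snd.comp .snd))
  computable_col := (Primrec.dom_finite fun i => (C i).2).comp .fst
  computable_part := by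
    have h : Primrec fun q : Witness r × (Fin r × ℕ × ℕ) => (q.2.1, q.2.2.1, q.1.1 q.2.1) :=
      (Primrec.fst.comp .snd).pair ((Primrec.fst.comp (Primrec.snd.comp .snd)).pair
        (Primrec.fin_app.comp (Primrec.fst.comp .fst) (Primrec.fst.comp .snd)))
    exact Primrec.list_map (Primrec.fst.comp .snd) h

/-- When the limit colors of the new elements are the labels of the witness, these elements can be
added, and the reservoirs cut beyond the oracle string so that the accepting computation is
preserved. -/
theorem Cond.exists_of_valid (c : S.Cond) (C : (Fin r → Fin 2) → Nat.Partrec.Code × Fin 3)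
    {w : Witness r} (hw : Valid c C w)
    (hlim : ∀ u ∈ w.2.1, S.lim u.1 (c.p u.1 u.2.1) = w.1 u.1) :
    ∃ d : S.Cond, S.Extends d c ∧ ∀ G, S.Follows G d →
      w.2.2.2.1 ∈ enumSet (C w.1).1 (finJoin fun s => G s (w.1 s)) := by
  obtain ⟨i, E, τ, n, t⟩ := w
  let E' : Fin r → Fin 2 → Set ℕ := fun s k => {y | k = i s ∧ ∃ u ∈ E, u.1 = s ∧ u.2.2 = y}
  obtain ⟨d, hd, hF, hb⟩ := c.exists_add (E := E')
    (fun s k => ((E.map fun u => u.2.2).finite_toSet).subset (by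
      rintro y ⟨-, u, hu, -, rfl⟩
      exact List.mem_map_of_mem (f := fun u : Fin r × ℕ × ℕ => u.2.2) hu))
    (by
      rintro _ k y ⟨rfl, u, hu, rfl, rfl⟩
      exact ⟨u.2.1, (hw.eq_p u hu).symm⟩)
    (by
      rintro _ k y ⟨rfl, u, hu, rfl, rfl⟩
      have h1 := S.lam_lim u.1 _ (c.mem_base u.1 u.2.1)
      rw [hw.eq_p u hu, ← h1, hlim u hu])
    (by
      rintro _ k y ⟨rfl, u, hu, rfl, rfl⟩ _ ⟨-, v, hv, hvu, rfl⟩ hlt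
      exact hw.hom u hu v hv hvu.symm hlt) τ.length
  refine ⟨d, hd, fun G hG => ⟨τ.length, t, ?_⟩⟩
  change Accepts (C i).1 _ n t
  -- Later elements exceed `τ.length`, and so do their codes in the join by `le_encode_pair`; hence
  -- they do not change this initial segment.
  have hτ : τ = initSeg (finJoin fun s => G s (i s)) τ.length := by
    refine eq_initSeg fun z hz => (hw.oracle z hz).trans ?_
    simp only [mem_finJoin]
    constructor
    · rintro (⟨s, x, hx, rfl⟩ | ⟨u, hu, rfl⟩)
      · exact ⟨s, x, hG.subset _ _ (hd.subset _ _ hx), rfl⟩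
      · refine ⟨u.1, u.2.2, hG.subset _ _ ?_, rfl⟩
        rw [hF]
        exact .inr ⟨rfl, u, hu, rfl, rfl⟩
    · rintro ⟨s, x, hx, rfl⟩
      rcases hG.subset_union _ _ hx with hx | ⟨m, rfl⟩
      · rw [hF] at hx
        rcases hx with hx | ⟨-, u, hu, rfl, rfl⟩
        · exact .inl ⟨s, x, hx, rfl⟩
        · exact .inr ⟨u, hu, rfl⟩
      · have := hb s m
        have := le_encode_pair s (d.p s m)
        omega
  rw [← hτ]
  exact hw.accepts

/-- Conversely, an accepting computation uses a finite part of the join, and the elements outside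
the condition with value below the use form the required finite extension. -/
theorem exists_valid_of_mem_enumSet (c : S.Cond)
    (C : (Fin r → Fin 2) → Nat.Partrec.Code × Fin 3) {G : Fin r → Fin 2 → Set ℕ}
    (hG : S.Follows G c) (i : Fin r → Fin 2) {n : ℕ}
    (hn : n ∈ enumSet (C i).1 (finJoin fun s => G s (i s))) :
    ∃ w : Witness r, Valid c C w ∧ w.1 = i ∧ w.2.2.2.1 = n ∧
      ∀ u ∈ w.2.1, u.2.2 ∈ G u.1 (i u.1) \ c.F u.1 (i u.1) := by
  classical
  obtain ⟨k, t, ht⟩ := hn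
  let B : Set (Fin r × ℕ × ℕ) := {u | u.2.2 = c.p u.1 u.2.1 ∧ u.2.2 < k ∧
    u.2.2 ∈ G u.1 (i u.1) \ c.F u.1 (i u.1)}
  have hB : B.Finite := by
    refine (Set.finite_univ.prod ((Set.finite_lt_nat k).prod (Set.finite_lt_nat k))).subset ?_
    rintro ⟨s, x, y⟩ ⟨h1, h2, -⟩
    refine ⟨trivial, ?_, h2⟩
    -- An increasing enumeration dominates the identity, so bounding values also bounds positions.
    exact ((c.mono s).le_apply (x := x)).trans_lt (h1 ▸ h2)
  refine ⟨(i, hB.toFinset.toList, initSeg (finJoin fun s => G s (i s)) k, n, t),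
    ⟨ht, ?_, ?_, ?_⟩, rfl, rfl, ?_⟩
  · intro u hu
    have hu : u ∈ B := by simpa using hu
    exact hu.1
  · rintro ⟨s, x, y⟩ hu ⟨s', x', y'⟩ hv rfl hlt
    have hu : (s, x, y) ∈ B := by simpa using hu
    have hv : (s, x', y') ∈ B := by simpa using hv
    exact hG.hom _ _ _ hu.2.2.1 _ hv.2.2.1 hlt
  · intro z hz
    have hz : z < k := by simpa [initSeg_length] using hz
    refine (initSeg_getElem?_eq_true hz).trans ?_
    simp only [mem_finJoin]
    constructor
    · rintro ⟨s, x, hx, rfl⟩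
      by_cases hxF : x ∈ c.F s (i s)
      · exact .inl ⟨s, x, hxF, rfl⟩
      · obtain ⟨m, rfl⟩ := (hG.subset_union _ _ hx).resolve_left hxF
        refine .inr ⟨(s, m, c.p s m), ?_, rfl⟩
        have : (s, m, c.p s m) ∈ B := ⟨rfl, (le_encode_pair s _).trans_lt hz, hx, hxF⟩
        simpa using this
    · rintro (⟨s, x, hx, rfl⟩ | ⟨u, hu, rfl⟩)
      · exact ⟨s, x, hG.subset _ _ hx, rfl⟩
      · have hu : u ∈ B := by simpa using hu
        exact ⟨u.1, u.2.2, hu.2.2.1, rfl⟩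
  · intro u hu
    have hu : u ∈ B := by simpa using hu
    exact hu.2.2

/-- Every condition has an extension which makes one of the functionals of a tuple enumerate a
finite set, or an element of the wrong color. -/
theorem Cond.exists_forcing (hM : IsCrossConstraintIdeal r M) {f : ℕ → Fin 3}
    (hf : ∀ Z ∈ M, HyperimmuneRel f Z) (c : S.Cond)
    (C : (Fin r → Fin 2) → Nat.Partrec.Code × Fin 3) :
    ∃ d : S.Cond, S.Extends d c ∧ ∀ G, S.Follows G d → ∃ i,
      (enumSet (C i).1 (finJoin fun s => G s (i s))).Finite ∨
      ∃ n ∈ enumSet (C i).1 (finJoin fun s => G s (i s)), f n ≠ (C i).2 := by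
  obtain ⟨D₁, hD₁, hp⟩ := hM.toIsTuringIdeal.exists_bound
    (A := fun s D => ComputableFrom D (c.p s)) (fun s D E h h' => h'.trans h) c.computable
  obtain ⟨D₂, hD₂, hγ⟩ := hM.toIsTuringIdeal.exists_bound
    (A := fun s D => ComputableFrom D fun p : ℕ × ℕ => S.γ s p.1 p.2)
    (fun s D E h h' => h'.trans h) S.computable_γ
  have hD := hM.join_mem _ hD₁ _ hD₂
  have hV := decidable_valid c C (fun s => (hp s).trans (computes_join_left D₁ D₂))
    (fun s => (hγ s).trans (computes_join_right D₁ D₂))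
  rcases (obstacles c C hV).exists_solution_or_meets hM hD (hf _ hD) with
    ⟨N, X, Y, hsol, hXY⟩ | hmeets
  -- Case of a solution in the ideal. The common colors chosen here give the tuple `i` whose
  -- functional will be confined to a finite set.
  · have hcol : ∀ s, ∃ k, {x | Y 0 s x = k ∧ Y 1 s x = k}.Infinite := fun s => by
      by_contra! h
      exact hsol.right s h
    choose i hi using hcol
    have hq : ∀ s, ∃ q : ℕ → ℕ, StrictMono q ∧ (∀ n, Y 0 s (q n) = i s ∧ Y 1 s (q n) = i s) ∧
        ComputableFrom (join (codePair (X 0) (Y 0)) (codePair (X 1) (Y 1))) q := fun s =>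
      exists_strictMono_of_infinite (.and
        ((decidable_codePair (X 0) (Y 0) s (i s)).trans (computes_join_left _ _))
        ((decidable_codePair (X 1) (Y 1) s (i s)).trans (computes_join_right _ _))) (hi s)
    choose q hqmono hqi hqc using hq
    -- The finite sets are unchanged; each reservoir is thinned to the positions where both paths
    -- guess `i s`.
    refine ⟨{
      F := c.F
      p := fun s n => c.p s (q s n)
      finite := c.finite
      mono := fun s => (c.mono s).comp (hqmono s)
      computable := fun s => ⟨_, hM.join_mem _ hD₁ _ hXY,
        ((hp s).trans (computes_join_left _ _)).comp ((hqc s).trans (computes_join_right _ _))⟩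
      mem_base := fun s n => c.mem_base s _
      hom := c.hom
      hom_reservoir := fun s k x hx n => c.hom_reservoir s k x hx _ },
      ⟨fun _ _ => subset_rfl, fun _ _ => Set.subset_union_left, ?_⟩, fun G hG => ⟨i, .inl ?_⟩⟩
    · rintro s _ ⟨n, rfl⟩
      exact ⟨_, rfl⟩
    · have hfin : {n | X 0 n = (C i).2 ∧ X 1 n = (C i).2}.Finite := hsol.left _
      refine ((Set.finite_le_nat N).union hfin).subset fun n hn => ?_
      by_cases hnN : n ≤ N
      · exact .inl hnN
      have hGc : S.Follows G c := ⟨hG.subset, fun s k x hx => (hG.subset_union s k hx).imp_right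
        (by rintro ⟨m, rfl⟩; exact ⟨_, rfl⟩), hG.hom⟩
      obtain ⟨w, hw, hwi, hwn, hu⟩ := exists_valid_of_mem_enumSet c C hGc i hn
      have hpart : ∀ j, ∀ u ∈ (obstacles c C hV).part w, Y j u.1 u.2.1 = u.2.2 := by
        intro j u' hu'
        obtain ⟨u, hu1, rfl⟩ := List.mem_map.1 hu'
        obtain ⟨hG1, hF1⟩ := hu u hu1
        obtain ⟨m, hm⟩ := (hG.subset_union _ _ hG1).resolve_left hF1
        have h1 : q u.1 m = u.2.1 := (c.mono u.1).injective (hm.trans (hw.eq_p u hu1))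
        change Y j u.1 u.2.1 = w.1 u.1
        rw [← h1, hwi]
        fin_cases j
        · exact (hqi u.1 m).1
        · exact (hqi u.1 m).2
      -- All new elements used lie in the thinned reservoirs, so both paths match the obstacle and
      -- must give `n` its color.
      have h2 : ∀ j, X j n = (C i).2 := fun j => by
        rw [← hwi, ← hwn]
        exact (obstacles c C hV).eq_col_of_isPath (hsol.path j) hw
          (by change N < w.2.2.2.1; omega) (hpart j)
      exact .inr ⟨h2 0, h2 1⟩
  -- The obstacle alternative holds for every `Y`, with no computability assumption, so it applies
  -- to the true limit colors.
  · obtain ⟨w, hw, hpart, hcol⟩ := hmeets fun s x => S.lim s (c.p s x)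
    obtain ⟨d, hd, hG⟩ := c.exists_of_valid C hw fun u hu =>
      hpart _ (List.mem_map_of_mem hu)
    exact ⟨d, hd, fun G h => ⟨w.1, .inr ⟨_, hG G h, hcol⟩⟩⟩

end StableFamily

end CrossConstraint

/-! ### The generic construction, and the reduction to stable colorings. -/

namespace CrossConstraint

open Encodable

namespace StableFamily

variable {r : ℕ} {M : Set (Set ℕ)} {S : StableFamily r M}

/-- Countably many requirements are met along a descending sequence of conditions. The unions of the
finite sets follow every condition of the sequence, since later additions come from earlier
reservoirs. -/
theorem exists_generic {ι : Type} [Countable ι] [Nonempty ι]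
    {P : ι → (Fin r → Fin 2 → Set ℕ) → Prop}
    (hP : ∀ j (c : S.Cond), ∃ d : S.Cond, S.Extends d c ∧ ∀ G, S.Follows G d → P j G)
    (c₀ : S.Cond) : ∃ G, S.Follows G c₀ ∧ ∀ j, P j G := by
  obtain ⟨e, he⟩ := exists_surjective_nat ι
  choose next hnext hforce using hP
  let c : ℕ → S.Cond := fun n => Nat.rec c₀ (fun m d => next (e m) d) n
  have hstep : ∀ n, S.Extends (c (n + 1)) (c n) := fun n => hnext (e n) (c n)
  have hext : ∀ n m, n ≤ m → S.Extends (c m) (c n) := fun n m h => by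
    induction m, h using Nat.le_induction with
    | base => exact .refl _
    | succ m _ ih => exact (hstep m).trans ih
  let G : Fin r → Fin 2 → Set ℕ := fun s k => ⋃ n, (c n).F s k
  have hG : ∀ n, S.Follows G (c n) := fun n => by
    refine ⟨fun s k => Set.subset_iUnion (fun n => (c n).F s k) n,
      fun s k => Set.iUnion_subset fun m => ?_, fun s k x hx y hy hxy => ?_⟩
    · exact ((hext m _ (le_max_left m n)).subset s k).trans
        ((hext n _ (le_max_right m n)).subset_union s k)
    · obtain ⟨a, ha⟩ := Set.mem_iUnion.1 hx
      obtain ⟨b, hb⟩ := Set.mem_iUnion.1 hy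
      exact (c (max a b)).hom s k x ((hext a _ (le_max_left a b)).subset s k ha)
        y ((hext b _ (le_max_right a b)).subset s k hb) hxy
  refine ⟨G, hG 0, fun j => ?_⟩
  obtain ⟨n, rfl⟩ := he j
  exact hforce (e n) (c n) G (hG (n + 1))

/-- The infinite homogeneous sets avoiding infinite `f`-homogeneous sets, for colorings with
limits. -/
theorem exists_avoiding (hM : IsCrossConstraintIdeal r M) {f : ℕ → Fin 3}
    (hf : ∀ Z ∈ M, HyperimmuneRel f Z) (c₀ : S.Cond) :
    ∃ (G : Fin r → Set ℕ) (k : Fin r → Fin 2),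
      (∀ s, (G s).Infinite ∧ ∀ x ∈ G s, ∀ y ∈ G s, x < y → S.γ s x y = k s) ∧
      ∀ H : Set ℕ, H.Infinite → Homogeneous₁ f H → ¬ Computes (finJoin G) H := by
  obtain ⟨G, hG, hreq⟩ := exists_generic (S := S)
    (ι := (Fin r × Fin 2 × ℕ) ⊕ ((Fin r → Fin 2) → Nat.Partrec.Code × Fin 3))
    (P := fun j G => j.elim (fun q => ∃ x ∈ G q.1 q.2.1, q.2.2 < x) fun C => ∃ i,
      (enumSet (C i).1 (finJoin fun s => G s (i s))).Finite ∨
      ∃ n ∈ enumSet (C i).1 (finJoin fun s => G s (i s)), f n ≠ (C i).2)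
    (by
      rintro (⟨s, k, b⟩ | C) c
      · obtain ⟨d, hd, x, hx, hbx⟩ := c.exists_gt s k b
        exact ⟨d, hd, fun G hG => ⟨x, hG.subset s k hx, hbx⟩⟩
      · exact c.exists_forcing hM hf C) c₀
  have hinf : ∀ s k, (G s k).Infinite := fun s k =>
    Set.infinite_of_forall_exists_gt fun b => hreq (.inl (s, k, b))
  suffices h : ∃ i : Fin r → Fin 2, ∀ H : Set ℕ, H.Infinite → Homogeneous₁ f H →
      ¬ Computes (finJoin fun s => G s (i s)) H by
    obtain ⟨i, hi⟩ := h
    exact ⟨fun s => G s (i s), fun s => S.lam s (i s),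
      fun s => ⟨hinf s _, hG.hom s (i s)⟩, hi⟩
  -- If every choice of labels computed an infinite `f`-homogeneous set, the corresponding codes and
  -- colors would form one tuple, whose requirement gives a contradiction.
  by_contra! hcon
  choose H hHinf hHom hH using hcon
  choose j hj using hHom
  choose e he using fun i => exists_enumSet_eq (hH i)
  obtain ⟨i, hi | ⟨n, hn, hne⟩⟩ := hreq (.inr fun i => (e i, j i))
  · rw [he] at hi
    exact hHinf i hi
  · rw [he] at hn
    exact hne (hj i n hn)

end StableFamily

open Classical in
/-- The color of the pair `x < y`, extended by `0` to all pairs. -/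
noncomputable def pairColor (g : IncPair → Fin 2) (x y : ℕ) : Fin 2 :=
  if h : x < y then g ⟨(x, y), h⟩ else 0

theorem decidable_pairColor (g : IncPair → Fin 2) :
    DecidableFrom (codeColoring g) fun p : ℕ × ℕ => pairColor g p.1 p.2 = 1 := by
  have h := computes_codeSet_iff.1 (TuringReducible.refl (charFun (codeColoring g)))
  refine (h.comp (f := fun p : ℕ × ℕ => (p, (1 : Fin 2)))
    (.of_primrec (Primrec.id.pair (.const 1)))).of_iff fun p => ?_
  by_cases hp : p.1 < p.2 <;> simp [pairColor, hp]

theorem computable_pairColor (g : IncPair → Fin 2) :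
    ComputableFrom (codeColoring g) fun p : ℕ × ℕ => pairColor g p.1 p.2 := by
  obtain ⟨b, hb, h⟩ := decidable_pairColor g
  have h1 : (fun p : ℕ × ℕ => pairColor g p.1 p.2) = fun p => cond (b p) 1 0 := by
    funext p
    cases hbp : b p with
    | true => exact (h p).1 hbp
    | false =>
      have h2 : pairColor g p.1 p.2 ≠ 1 := fun h3 => by simp [(h p).2 h3] at hbp
      simp only [cond_false]
      omega
  rw [h1]
  exact .comp (f := fun b : Bool => cond b (1 : Fin 2) 0)
    (.of_primrec (Primrec.dom_bool fun b => cond b (1 : Fin 2) 0)) hb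

/-- In a model of `COH`, a coloring of pairs is stable on some infinite set of the ideal; and
either the limit color is constant there, or both limit colors appear in all infinite subsets
in the ideal. -/
theorem exists_stable {M : Set (Set ℕ)} (hM : IsTuringIdeal M) (hCOH : ModelsCOH M)
    {g : IncPair → Fin 2} (hg : codeColoring g ∈ M) :
    ∃ (base : Set ℕ) (lim : ℕ → Fin 2) (lam : Fin 2 → Fin 2) (p₀ : ℕ → ℕ),
      (∀ x ∈ base, {y ∈ base | pairColor g x y ≠ lim x}.Finite) ∧
      (∀ x ∈ base, lam (lim x) = lim x) ∧
      (∀ k (p : ℕ → ℕ), StrictMono p → (∀ n, p n ∈ base) →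
        (∃ D ∈ M, ComputableFrom D p) → ∃ n, lim (p n) = lam k) ∧
      StrictMono p₀ ∧ (∀ n, p₀ n ∈ base) ∧ ∃ D ∈ M, ComputableFrom D p₀ := by
  classical
  obtain ⟨C, hC, hCinf, hcoh⟩ := hCOH (fun x => {y | pairColor g x y = 1})
    (hM.downward _ hg _ (computes_codeSet_iff.2 (decidable_pairColor g)))
  -- Cohesiveness for the sections of the coloring makes each of them eventually constant on `C`.
  let lim : ℕ → Fin 2 := fun x => if (C \ {y | pairColor g x y = 1}).Finite then 1 else 0
  have hlim : ∀ x, {y ∈ C | pairColor g x y ≠ lim x}.Finite := by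
    intro x
    by_cases h : (C \ {y | pairColor g x y = 1}).Finite
    · refine h.subset fun y hy => ⟨hy.1, ?_⟩
      simpa [lim, h] using hy.2
    · refine ((hcoh x).resolve_left h).subset fun y hy => ⟨hy.1, ?_⟩
      have h1 : pairColor g x y ≠ 0 := by simpa [lim, h] using hy.2
      simp only [Set.mem_compl_iff, Set.mem_ofPred_eq, not_not]
      omega
  by_cases hconst : ∃ k, ∃ p : ℕ → ℕ, StrictMono p ∧ (∀ n, p n ∈ C) ∧
      (∃ D ∈ M, ComputableFrom D p) ∧ ∀ n, lim (p n) = k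
  · obtain ⟨k, p, hp, hpC, hpM, hk⟩ := hconst
    -- With a constant limit color `k` on the base, both labels are sent to `k`.
    refine ⟨Set.range p, lim, fun _ => k, p, fun x _ => (hlim x).subset ?_, ?_, ?_, hp,
      fun n => ⟨n, rfl⟩, hpM⟩
    · rintro _ ⟨⟨n, rfl⟩, h⟩
      exact ⟨hpC n, h⟩
    · rintro _ ⟨n, rfl⟩
      exact (hk n).symm
    · intro _ q _ hq _
      obtain ⟨m, hm⟩ := hq 0
      exact ⟨0, hm ▸ hk m⟩
  · obtain ⟨p₀, hp₀, hpC, hpc⟩ := exists_strictMono_of_infinite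
      (DecidableFrom.self (D := C)) hCinf
    refine ⟨C, lim, id, p₀, fun x _ => hlim x, fun _ _ => rfl, ?_, hp₀, hpC, C, hC, hpc⟩
    intro k p hp hpC hpM
    by_contra! h
    -- A sequence in the ideal that avoids limit color `k` has constant limit color `1 - k`, which
    -- this case excludes.
    refine hconst ⟨1 - k, p, hp, hpC, hpM, fun n => ?_⟩
    have := h n
    simp only [id] at this
    omega

end CrossConstraint

theorem mainTheorem5 (r : ℕ) (M : Set (Set ℕ)) (hcount : M.Countable)
    (hM : CrossConstraint.IsCrossConstraintIdeal r M) (hCOH : CrossConstraint.ModelsCOH M)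
    (f : ℕ → Fin 3) (hf : ∀ Z ∈ M, CrossConstraint.HyperimmuneRel f Z)
    (g : Fin r → CrossConstraint.IncPair → Fin 2)
    (hg : ∀ i, CrossConstraint.codeColoring (g i) ∈ M) :
    ∃ G : Fin r → Set ℕ,
      (∀ i, (G i).Infinite ∧ CrossConstraint.Homogeneous₂ (g i) (G i)) ∧
      ∀ H : Set ℕ, H.Infinite → CrossConstraint.Homogeneous₁ f H →
        ¬ CrossConstraint.Computes (CrossConstraint.finJoin G) H := by
  choose base lim lam p₀ hlim hlam hex hmono hbase hcomp using
    fun s => CrossConstraint.exists_stable hM.toIsTuringIdeal hCOH (hg s)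
  let S : CrossConstraint.StableFamily r M :=
    { γ := fun s => CrossConstraint.pairColor (g s)
      base := base
      lim := lim
      lam := lam
      computable_γ := fun s => ⟨_, hg s, CrossConstraint.computable_pairColor (g s)⟩
      finite_ne_lim := hlim
      lam_lim := hlam
      exists_lim_eq := hex }
  let c₀ : S.Cond :=
    { F := fun _ _ => ∅
      p := p₀
      finite := fun _ _ => Set.finite_empty
      mono := hmono
      computable := hcomp
      mem_base := hbase
      hom := fun _ _ _ hx => hx.elim
      hom_reservoir := fun _ _ _ hx => hx.elim }
  obtain ⟨G, k, hG, hH⟩ := CrossConstraint.StableFamily.exists_avoiding hM hf c₀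
  refine ⟨G, fun s => ⟨(hG s).1, k s, fun x hx y hy h => ?_⟩, hH⟩
  rw [← (hG s).2 x hx y hy h]
  simp [S, CrossConstraint.pairColor, h]
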